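/- Let $a<b$, $T>0$, $0<\gamma<1$, and let $u$ be a solution of $$\frac{\partial u}{\partial t}(x,t)+\int_a^b\frac{u(x,t)-u(y,t)}{|x-y|^{\gamma}}\,dy=f(x,t),\qquad (x,t)\in(a,b)\times(0,T],$$ with initial condition $u(x,0)=u_0(x)$ for $x\in(a,b)$ and Dirichlet boundary conditions $u(a,t)=g_a(t)$, $u(b,t)=g_b(t)$ for $t\in(0,T]$, such that $\partial_x^j u$ $(0\le j\le 4)$ and $\partial_t^j u$ $(0\le j\le 3)$ exist and are continuous on $[a,b]\times[0,T]$. For integers $M\ge 1$, $N\ge 0$ and $\tau>0$ with $N\tau\le T$ put $h=(b-a)/M$, $x_{i/2}=a+\tfrac i2h$ $(0\le i\le 2M)$, $t_k=k\tau$, $t_{k-\frac12}=(k-\tfrac12)\tau$. Let $\phi_{j/2}$ $(0\le j\le 2M)$ be the piecewise quadratic Lagrange basis: $\phi_{j/2}$ is continuous on $[a,b]$, is a polynomial of degree at most $2$ on each cell $[x_m,x_{m+1}]$, $0\le m<M$, and $\phi_{j/2}(x_{i/2})=\delta_{ij}$. Put $$d_{i/2}=\int_a^b\frac{dy}{|x_{i/2}-y|^{\gamma}},\qquad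 g_{i,j}=\int_a^b\frac{\phi_{j/2}(y)}{|x_{i/2}-y|^{\gamma}}\,dy,\qquad \mathcal A=\big(d_{i/2}\,\delta_{ij}-g_{i,j}\big)_{i,j=1}^{2M-1},$$ and consider the Crank–Nicolson collocation scheme for the vectors $U^k=(u^k_{i/2})_{i=1}^{2M-1}$, $k=0,\dots,N$: $$u^0_{i/2}=u_0(x_{i/2}),\qquad \Big(I+\frac\tau2\mathcal A\Big)U^k=\Big(I-\frac\tau2\mathcal A\Big)U^{k-1}+\tau F^{k-\frac12}+\tau K^{k-\frac12},\quad 1\le k\le N,$$ where $F^{k-\frac12}_i=f(x_{i/2},t_{k-\frac12})$ and $K^{k-\frac12}_i=g_{i,0}\,g_a(t_{k-\frac12})+g_{i,2M}\,g_b(t_{k-\frac12})$. Then there is a constant $C>0$, which does not depend on $M$, $N$, $\tau$, such that for all $M\ge1$, $N\ge0$ and $\tau>0$ with $N\tau\le T$ the scheme has exactly one solution, and this solution satisfies $$\max_{0\le k\le N}\ \max_{1\le i\le 2M-1}\big|u(x_{i/2},t_k)-u^k_{i/2}\big|\le C\,\big(\tau^2+h^{4-\gamma}\big).$$ -/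

import Mathlib

namespace NonlocalCN

/-- The point `x_s = a + s h` of the uniform mesh of step `h`, for a real index `s`. The mesh nodes
are the `x_{l/2}` with `l = 0, 1, …, 2M`. -/
noncomputable def mesh (a h s : ℝ) : ℝ := a + s * h

/-- The piecewise quadratic Lagrange basis function `φ_{l/2}` of the mesh with nodes `x_{l/2}` and
cells `[x_m, x_{m+1}]`. It belongs to a cell endpoint when `l` is even and to a cell midpoint when
`l` is odd. Only its restriction to `[a, b]` is used, so that `φ_0` and `φ_M` (whose formulas extend
outside `[a, b]`) are the usual one-sided functions there. -/
noncomputable def quadBasis (a h : ℝ) (l : ℕ) (y : ℝ) : ℝ :=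
  let s : ℝ := (l : ℝ) / 2
  if Even l then
    if y ∈ Set.Icc (mesh a h (s - 1)) (mesh a h s) then
      (y - mesh a h (s - 1)) / h * ((2 * y - (mesh a h s + mesh a h (s - 1))) / h)
    else if y ∈ Set.Icc (mesh a h s) (mesh a h (s + 1)) then
      (mesh a h (s + 1) - y) / h * (((mesh a h (s + 1) + mesh a h s) - 2 * y) / h)
    else 0
  else
    if y ∈ Set.Icc (mesh a h (s - 1 / 2)) (mesh a h (s + 1 / 2)) then
      4 * (y - mesh a h (s - 1 / 2)) * (mesh a h (s + 1 / 2) - y) / h ^ 2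
    else 0

/-- The spatial step `h = (b - a) / M`. -/
noncomputable def step (a b : ℝ) (M : ℕ) : ℝ := (b - a) / M

/-- The interior node number `i + 1`, that is `x_{(i+1)/2}`; for `i : Fin (2M - 1)` these are
`x_{1/2}, x_1, …, x_{M-1/2}`. -/
noncomputable def node (a b : ℝ) (M : ℕ) (i : Fin (2 * M - 1)) : ℝ :=
  mesh a (step a b M) (((i : ℕ) + 1 : ℝ) / 2)

/-- `d_{i/2} = ∫_a^b |x_{i/2} - y|^{-γ} dy`. -/
noncomputable def diagCoeff (a b γ : ℝ) (M : ℕ) (i : Fin (2 * M - 1)) : ℝ :=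
  ∫ y in a..b, 1 / |node a b M i - y| ^ γ

/-- `∫_a^b φ_{l/2}(y) |x_{i/2} - y|^{-γ} dy`. -/
noncomputable def weight (a b γ : ℝ) (M : ℕ) (i : Fin (2 * M - 1)) (l : ℕ) : ℝ :=
  ∫ y in a..b, quadBasis a (step a b M) l y / |node a b M i - y| ^ γ

/-- The collocation matrix `A = D - G`, in the natural ordering of the interior nodes. -/
noncomputable def stiffness (a b γ : ℝ) (M : ℕ) :
    Matrix (Fin (2 * M - 1)) (Fin (2 * M - 1)) ℝ :=
  Matrix.diagonal (diagCoeff a b γ M) -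
    Matrix.of fun i (j : Fin (2 * M - 1)) => weight a b γ M i ((j : ℕ) + 1)

/-- The contribution of the boundary values `ua` (at `x = a`) and `ub` (at `x = b`). -/
noncomputable def boundaryVec (a b γ : ℝ) (M : ℕ) (ua ub : ℝ) : Fin (2 * M - 1) → ℝ :=
  fun i => weight a b γ M i 0 * ua + weight a b γ M i (2 * M) * ub

/-- `U` solves the Crank–Nicolson piecewise quadratic collocation scheme with time step `τ`,
source `f`, initial value `u₀` and boundary values `ga`, `gb`:
`(I + τ/2 A) U^{k+1} = (I - τ/2 A) U^k + τ F^{k+1/2} + τ K^{k+1/2}` for `0 ≤ k < N`, where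
`F^{k+1/2}` and `K^{k+1/2}` are taken at the time `t_{k+1/2} = (k + 1/2) τ`. -/
def IsSchemeSolution (a b γ : ℝ) (f : ℝ → ℝ → ℝ) (u₀ ga gb : ℝ → ℝ) (M N : ℕ) (τ : ℝ)
    (U : Fin (N + 1) → Fin (2 * M - 1) → ℝ) : Prop :=
  (∀ i, U 0 i = u₀ (node a b M i)) ∧
  ∀ k : Fin N,
    (1 + (τ / 2) • stiffness a b γ M).mulVec (U k.succ) =
      (1 - (τ / 2) • stiffness a b γ M).mulVec (U k.castSucc)
        + τ • (fun i => f (node a b M i) (((k : ℕ) + 1 / 2 : ℝ) * τ))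
        + τ • boundaryVec a b γ M (ga (((k : ℕ) + 1 / 2 : ℝ) * τ)) (gb (((k : ℕ) + 1 / 2 : ℝ) * τ))

/-- `∂_x^j u` for `j ≤ 4` and `∂_t^j u` for `j ≤ 3` exist and are continuous on the closed rectangle
`[a, b] × [0, T]` (one-sided derivatives at the boundary). -/
structure IsSmooth (a b T : ℝ) (u : ℝ → ℝ → ℝ) : Prop where
  space : ∀ t ∈ Set.Icc 0 T, ContDiffOn ℝ 4 (fun x => u x t) (Set.Icc a b)
  time : ∀ x ∈ Set.Icc a b, ContDiffOn ℝ 3 (fun t => u x t) (Set.Icc 0 T)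
  space_cont : ∀ j ≤ 4, ContinuousOn
    (fun p : ℝ × ℝ => iteratedDerivWithin j (fun x => u x p.2) (Set.Icc a b) p.1)
    (Set.Icc a b ×ˢ Set.Icc 0 T)
  time_cont : ∀ j ≤ 3, ContinuousOn
    (fun p : ℝ × ℝ => iteratedDerivWithin j (fun t => u p.1 t) (Set.Icc 0 T) p.2)
    (Set.Icc a b ×ˢ Set.Icc 0 T)

/-- `u` solves `∂_t u(x,t) + ∫_a^b (u(x,t) - u(y,t)) / |x - y|^γ dy = f(x,t)` on `(a,b) × (0,T]`
with initial value `u₀` and Dirichlet boundary values `ga` at `a` and `gb` at `b`. -/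
structure IsExactSolution (a b T γ : ℝ) (f : ℝ → ℝ → ℝ) (u₀ ga gb : ℝ → ℝ)
    (u : ℝ → ℝ → ℝ) : Prop where
  eqn : ∀ x ∈ Set.Ioo a b, ∀ t ∈ Set.Ioc 0 T,
    derivWithin (fun s => u x s) (Set.Icc 0 T) t + ∫ y in a..b, (u x t - u y t) / |x - y| ^ γ
      = f x t
  initial : ∀ x ∈ Set.Ioo a b, u x 0 = u₀ x
  left : ∀ t ∈ Set.Ioc 0 T, u a t = ga t
  right : ∀ t ∈ Set.Ioc 0 T, u b t = gb t

end NonlocalCN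

/-! The error is controlled in the maximum norm by consistency and stability.

Space consistency. On a cell with centre `c` and half-width `r`, the quadratic interpolation error
is `κ ((y - c)^3 - r^2 (y - c)) + O(h^4)`. The cubic is odd about `c`, so it integrates to zero
against any constant, and only the variation of the kernel across the cell matters. The kernel is
singular at the node, so it is first frozen at `h^{-γ}` within distance `h`. Freezing costs
`O(h^{1-γ})` in `L¹`, and the frozen kernel has total variation at most `2 h^{-γ}`. Multiplied by
`h^3` and `h^3 · h` respectively, both effects are `O(h^{4-γ})`, and the quartic remainder gives
`O(h^4)` (`abs_integral_sub_sum_quadBasis_le`).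

Stability. All weights `g_{i,l}` are nonnegative, although the basis functions at cell endpoints
change sign (`weight_nonneg`), and they sum to `d_{i/2}` over all `l`. Hence `A` is diagonally
dominant with nonpositive off-diagonal part, and a maximum principle makes `(I + τ/2 A)⁻¹` a
contraction. Since `d_{i/2} ≤ D` uniformly in the mesh, the explicit factor has norm at most `1 + τ
D`, so errors grow at most like `e^{TD}` (`abs_le_of_implicit_recursion`).

Time consistency. Expansion about the half step gives `O(τ^2)`. The averaging error passes through
the bounded matrix `A`, so no mixed derivatives of `u` are needed. -/

open MeasureTheory Set

namespace NonlocalCN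

/-! ### The weakly singular kernel and its truncation -/

section Kernel

variable {γ : ℝ}

lemma kernel_nonneg (x y : ℝ) : 0 ≤ 1 / |x - y| ^ γ := by positivity

lemma intervalIntegrable_inv_abs_rpow (hγ : γ < 1) (c d : ℝ) :
    IntervalIntegrable (fun z : ℝ => 1 / |z| ^ γ) volume c d := by
  refine intervalIntegrable_of_even (fun z => by simp) (fun z hz => ?_)
  refine (intervalIntegral.intervalIntegrable_rpow' (r := -γ) (by linarith)).congr ?_
  intro y hy
  rw [uIoc_of_le hz.le] at hy
  simp only
  rw [abs_of_pos hy.1, Real.rpow_neg hy.1.le, one_div]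

lemma intervalIntegrable_kernel (hγ : γ < 1) (x c d : ℝ) :
    IntervalIntegrable (fun y : ℝ => 1 / |x - y| ^ γ) volume c d := by
  have := (intervalIntegrable_inv_abs_rpow hγ (x - c) (x - d)).comp_sub_left x
  simpa using this

lemma integral_inv_abs_rpow (hγ : γ < 1) {r : ℝ} (hr : 0 ≤ r) :
    ∫ z in (0 : ℝ)..r, 1 / |z| ^ γ = r ^ (1 - γ) / (1 - γ) := by
  have h : ∫ z in (0 : ℝ)..r, 1 / |z| ^ γ = ∫ z in (0 : ℝ)..r, z ^ (-γ) := by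
    refine intervalIntegral.integral_congr fun y hy => ?_
    rw [uIcc_of_le hr] at hy
    rw [abs_of_nonneg hy.1, Real.rpow_neg hy.1, one_div]
  rw [h, integral_rpow (Or.inl (by linarith)), Real.zero_rpow (by linarith)]
  rw [show -γ + 1 = 1 - γ by ring, sub_zero]

lemma integral_kernel_symm (hγ : γ < 1) (x : ℝ) {r : ℝ} (hr : 0 ≤ r) :
    ∫ y in (x - r)..(x + r), 1 / |x - y| ^ γ = 2 / (1 - γ) * r ^ (1 - γ) := by
  rw [intervalIntegral.integral_comp_sub_left (fun z : ℝ => 1 / |z| ^ γ) x]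
  rw [show x - (x + r) = -r by ring, show x - (x - r) = r by ring]
  rw [← intervalIntegral.integral_add_adjacent_intervals
    (intervalIntegrable_inv_abs_rpow hγ (-r) 0) (intervalIntegrable_inv_abs_rpow hγ 0 r)]
  have h : ∫ z in (-r)..0, 1 / |z| ^ γ = ∫ z in (0 : ℝ)..r, 1 / |z| ^ γ := by
    have := intervalIntegral.integral_comp_neg (a := 0) (b := r) (fun z : ℝ => 1 / |z| ^ γ)
    simpa using this.symm
  rw [h, integral_inv_abs_rpow hγ hr]
  ring

lemma integral_kernel_le (hγ : γ < 1) {a b x : ℝ} (hx : x ∈ Icc a b) :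
    ∫ y in a..b, 1 / |x - y| ^ γ ≤ 2 / (1 - γ) * (b - a) ^ (1 - γ) := by
  have hab : a ≤ b := hx.1.trans hx.2
  rw [← integral_kernel_symm hγ x (sub_nonneg.2 hab)]
  refine intervalIntegral.integral_mono_interval (by linarith [hx.2]) hab (by linarith [hx.1])
    (Filter.Eventually.of_forall fun y => kernel_nonneg x y) (intervalIntegrable_kernel hγ _ _ _)

/-- The kernel `|x - y|^{-γ}`, frozen at its value `h^{-γ}` for `|x - y| ≤ h`. -/
noncomputable def truncKernel (γ h x y : ℝ) : ℝ := 1 / (max |x - y| h) ^ γ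

lemma continuous_truncKernel {h : ℝ} (hh : 0 < h) (x : ℝ) : Continuous (truncKernel γ h x) := by
  have hpos : ∀ y : ℝ, 0 < max |x - y| h := fun y => lt_max_of_lt_right hh
  refine continuous_const.div ?_ fun y => (Real.rpow_pos_of_pos (hpos y) γ).ne'
  refine Continuous.rpow_const ?_ fun y => Or.inl (hpos y).ne'
  fun_prop

lemma truncKernel_nonneg {h : ℝ} (hh : 0 < h) (x y : ℝ) : 0 ≤ truncKernel γ h x y := by
  have : 0 < max |x - y| h := lt_max_of_lt_right hh
  unfold truncKernel
  positivity

lemma truncKernel_anti (hγ : 0 ≤ γ) {h x y z : ℝ} (hh : 0 < h) (hyz : |x - y| ≤ |x - z|) :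
    truncKernel γ h x z ≤ truncKernel γ h x y := by
  have : 0 < max |x - y| h := lt_max_of_lt_right hh
  exact one_div_le_one_div_of_le (by positivity)
    (Real.rpow_le_rpow this.le (max_le_max_right h hyz) hγ)

lemma truncKernel_le (hγ : 0 ≤ γ) {h : ℝ} (hh : 0 < h) (x y : ℝ) :
    truncKernel γ h x y ≤ 1 / h ^ γ :=
  one_div_le_one_div_of_le (by positivity) (Real.rpow_le_rpow hh.le (le_max_right _ _) hγ)

/-- A monotone function whose increments dominate those of `truncKernel`. -/
noncomputable def kernelVariation (γ h x y : ℝ) : ℝ :=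
  if x ≤ y then 1 / h ^ γ - truncKernel γ h x y else truncKernel γ h x y - 1 / h ^ γ

lemma abs_kernelVariation (hγ : 0 ≤ γ) {h : ℝ} (hh : 0 < h) (x y : ℝ) :
    |kernelVariation γ h x y| = 1 / h ^ γ - truncKernel γ h x y := by
  have := truncKernel_le hγ hh x y
  unfold kernelVariation
  split_ifs
  · exact abs_of_nonneg (by linarith)
  · rw [abs_of_nonpos (by linarith)]
    ring

lemma abs_kernelVariation_le (hγ : 0 ≤ γ) {h : ℝ} (hh : 0 < h) (x y : ℝ) :
    |kernelVariation γ h x y| ≤ 1 / h ^ γ := by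
  rw [abs_kernelVariation hγ hh]
  linarith [truncKernel_nonneg (γ := γ) hh x y]

lemma monotone_kernelVariation (hγ : 0 ≤ γ) {h : ℝ} (hh : 0 < h) (x : ℝ) :
    Monotone (kernelVariation γ h x) := by
  intro y z hyz
  have hy := truncKernel_le hγ hh x y
  have hz := truncKernel_le hγ hh x z
  unfold kernelVariation
  split_ifs with h1 h2 h2
  · have := truncKernel_anti (x := x) (y := y) (z := z) hγ hh (by
      rw [abs_of_nonpos (by linarith), abs_of_nonpos (by linarith)]; linarith)
    linarith
  · linarith
  · linarith
  · have := truncKernel_anti (x := x) (y := z) (z := y) hγ hh (by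
      push Not at h1 h2
      rw [abs_of_nonneg (by linarith), abs_of_nonneg (by linarith)]; linarith)
    linarith

/-- Up to the constant `1 / h ^ γ`, `truncKernel` is minus the absolute value of `kernelVariation`,
so the reverse triangle inequality transfers increments. The right-hand side telescopes over
adjacent cells. -/
lemma abs_truncKernel_sub_le (hγ : 0 ≤ γ) {h : ℝ} (hh : 0 < h) {x p q y z : ℝ}
    (hy : y ∈ Icc p q) (hz : z ∈ Icc p q) :
    |truncKernel γ h x y - truncKernel γ h x z| ≤
      kernelVariation γ h x q - kernelVariation γ h x p := by
  have hm := monotone_kernelVariation hγ hh x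
  have h1 : |truncKernel γ h x y - truncKernel γ h x z| =
      |(|kernelVariation γ h x z| - |kernelVariation γ h x y|)| := by
    rw [abs_kernelVariation hγ hh, abs_kernelVariation hγ hh]
    congr 1
    ring
  rw [h1]
  refine (abs_abs_sub_abs_le_abs_sub _ _).trans ?_
  have := hm hy.1
  have := hm hy.2
  have := hm hz.1
  have := hm hz.2
  rw [abs_le]
  constructor <;> linarith

/-- The two kernels agree once `|x - y| ≥ h`, so only a window of width `2h` contributes. -/
lemma integral_abs_kernel_sub_truncKernel_le (hγ0 : 0 ≤ γ) (hγ : γ < 1) {a b x h : ℝ}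
    (hx : x ∈ Icc a b) (hh : 0 < h) (hhab : h ≤ b - a) :
    ∫ y in a..b, |1 / |x - y| ^ γ - truncKernel γ h x y| ≤
      (2 / (1 - γ) + 2) * h ^ (1 - γ) := by
  have hint : ∀ c d, IntervalIntegrable (fun y => |1 / |x - y| ^ γ - truncKernel γ h x y|)
      volume c d := fun c d => ((intervalIntegrable_kernel hγ x c d).sub
        ((continuous_truncKernel hh x).intervalIntegrable c d)).abs
  have hfar : ∀ y, h ≤ |x - y| → |1 / |x - y| ^ γ - truncKernel γ h x y| = 0 := by
    intro y hy
    rw [truncKernel, max_eq_left hy, sub_self, abs_zero]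
  calc ∫ y in a..b, |1 / |x - y| ^ γ - truncKernel γ h x y|
      ≤ ∫ y in (x - (b - a))..(x + (b - a)), |1 / |x - y| ^ γ - truncKernel γ h x y| :=
        intervalIntegral.integral_mono_interval (by linarith [hx.2]) (by linarith)
          (by linarith [hx.1]) (Filter.Eventually.of_forall fun y => abs_nonneg _) (hint _ _)
    _ = ∫ y in (x - h)..(x + h), |1 / |x - y| ^ γ - truncKernel γ h x y| := by
        rw [← intervalIntegral.integral_add_adjacent_intervals (hint (x - (b - a)) (x - h))
          (hint (x - h) _), ← intervalIntegral.integral_add_adjacent_intervals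
          (hint (x - h) (x + h)) (hint (x + h) _)]
        have h1 : ∫ y in (x - (b - a))..(x - h), |1 / |x - y| ^ γ - truncKernel γ h x y| = 0 := by
          rw [← intervalIntegral.integral_zero (μ := volume) (a := x - (b - a)) (b := x - h)]
          refine intervalIntegral.integral_congr fun y hy => hfar y ?_
          rw [uIcc_of_le (by linarith)] at hy
          rw [abs_of_nonneg (by linarith [hy.2])]
          linarith [hy.2]
        have h2 : ∫ y in (x + h)..(x + (b - a)), |1 / |x - y| ^ γ - truncKernel γ h x y| = 0 := by
          rw [← intervalIntegral.integral_zero (μ := volume) (a := x + h) (b := x + (b - a))]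
          refine intervalIntegral.integral_congr fun y hy => hfar y ?_
          rw [uIcc_of_le (by linarith)] at hy
          rw [abs_of_nonpos (by linarith [hy.1])]
          linarith [hy.1]
        rw [h1, h2]
        ring
    _ ≤ ∫ y in (x - h)..(x + h), (1 / |x - y| ^ γ + 1 / h ^ γ) := by
        refine intervalIntegral.integral_mono_on (by linarith) (hint _ _)
          ((intervalIntegrable_kernel hγ x _ _).add (by simp)) fun y _ => ?_
        have := truncKernel_le hγ0 hh x y
        have := truncKernel_nonneg (γ := γ) hh x y
        have := kernel_nonneg (γ := γ) x y
        rw [abs_le]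
        constructor <;> linarith
    _ = (2 / (1 - γ) + 2) * h ^ (1 - γ) := by
        rw [intervalIntegral.integral_add (intervalIntegrable_kernel hγ x _ _) (by simp),
          integral_kernel_symm hγ x hh.le, intervalIntegral.integral_const, Real.rpow_sub hh,
          Real.rpow_one, smul_eq_mul]
        ring

end Kernel

/-! ### Taylor estimates with one-sided derivatives -/

section Taylor

lemma abs_le_of_hasDerivWithinAt_of_pow {p q c K : ℝ} {n : ℕ} {G G' : ℝ → ℝ} (hK : 0 ≤ K)
    (hG : ∀ x ∈ Icc p q, HasDerivWithinAt G (G' x) (Icc p q) x) (hc : c ∈ Icc p q) (hGc : G c = 0)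
    (hG' : ∀ x ∈ Icc p q, |G' x| ≤ K * |x - c| ^ n) {y : ℝ} (hy : y ∈ Icc p q) :
    |G y| ≤ K * |y - c| ^ (n + 1) := by
  have hsub : uIcc c y ⊆ Icc p q := ordConnected_Icc.uIcc_subset hc hy
  have := Convex.norm_image_sub_le_of_norm_hasDerivWithin_le (f := G) (f' := G') (s := uIcc c y)
    (C := K * |y - c| ^ n) (fun z hz => (hG z (hsub hz)).mono hsub) (fun z hz => by
      refine (hG' z (hsub hz)).trans ?_
      gcongr ?_ * ?_ ^ n
      exact abs_sub_left_of_mem_uIcc hz) (convex_uIcc c y) left_mem_uIcc right_mem_uIcc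
  rw [hGc, sub_zero, Real.norm_eq_abs, Real.norm_eq_abs] at this
  rwa [pow_succ, ← mul_assoc]

/-- The derivative of the remainder is the remainder of the derivative, so the induction shifts the
sequence by one. Each step uses the mean value inequality, not an integral, which is why no `1 / n!`
appears. -/
lemma abs_taylor_remainder_le {p q c K : ℝ} (hK : 0 ≤ K) (hc : c ∈ Icc p q) (n : ℕ) :
    ∀ f : ℕ → ℝ → ℝ,
      (∀ j < n, ∀ x ∈ Icc p q, HasDerivWithinAt (f j) (f (j + 1) x) (Icc p q) x) →
      (∀ x ∈ Icc p q, |f n x| ≤ K) → ∀ y ∈ Icc p q,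
      |f 0 y - ∑ j ∈ Finset.range n, f j c * (y - c) ^ j / (j.factorial : ℝ)| ≤
        K * |y - c| ^ n := by
  induction n with
  | zero =>
    intro f _ hb y hy
    simpa using hb y hy
  | succ n ih =>
    intro f hf hb y hy
    have ih' := ih (fun j => f (j + 1)) (fun j hj => hf (j + 1) (by omega)) hb
    refine abs_le_of_hasDerivWithinAt_of_pow (n := n) hK
      (G := fun y => f 0 y - ∑ j ∈ Finset.range (n + 1), f j c * (y - c) ^ j / (j.factorial : ℝ))
      ?_ hc ?_ ih' hy
    · intro x hx
      refine (hf 0 (by omega) x hx).sub ?_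
      simp only [Finset.sum_range_succ']
      have : HasDerivAt (fun y => ∑ j ∈ Finset.range n,
          f (j + 1) c * (y - c) ^ (j + 1) / ((j + 1).factorial : ℝ))
          (∑ j ∈ Finset.range n, f (j + 1) c * (x - c) ^ j / (j.factorial : ℝ)) x := by
        refine HasDerivAt.fun_sum fun j _ => ?_
        have h1 : HasDerivAt (fun y : ℝ => (y - c) ^ (j + 1)) (((j + 1 : ℕ) : ℝ) * (x - c) ^ j) x := by
          simpa using ((hasDerivAt_id' x).sub_const c).fun_pow (j + 1)
        have h2 := (h1.const_mul (f (j + 1) c)).div_const ((j + 1).factorial : ℝ)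
        refine h2.congr_deriv ?_
        rw [Nat.factorial_succ]
        push_cast
        have : (j.factorial : ℝ) ≠ 0 := by positivity
        have : (j : ℝ) + 1 ≠ 0 := by positivity
        field_simp
      simpa using this.hasDerivWithinAt
    · simp [Finset.sum_range_succ']

lemma abs_sub_taylor_le_of_contDiffOn {p q c K : ℝ} (hpq : p < q) (hc : c ∈ Icc p q) {n : ℕ}
    {f : ℝ → ℝ} (hf : ContDiffOn ℝ n f (Icc p q))
    (hK : ∀ x ∈ Icc p q, |iteratedDerivWithin n f (Icc p q) x| ≤ K) {y : ℝ} (hy : y ∈ Icc p q) :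
    |f y - ∑ j ∈ Finset.range n,
      iteratedDerivWithin j f (Icc p q) c * (y - c) ^ j / (j.factorial : ℝ)| ≤ K * |y - c| ^ n := by
  have := abs_taylor_remainder_le ((abs_nonneg _).trans (hK c hc)) hc n
    (fun j => iteratedDerivWithin j f (Icc p q)) (fun j hj x hx => ?_) hK y hy
  · simpa using this
  · simp only [iteratedDerivWithin_succ]
    exact (hf.differentiableOn_iteratedDerivWithin (by exact_mod_cast hj)
      (uniqueDiffOn_Icc hpq) x hx).hasDerivWithinAt

/-- The even Taylor terms cancel in the symmetric difference. -/
lemma abs_central_difference_sub_le {p q t δ K : ℝ} (hpq : p < q) (hδ : 0 ≤ δ) (ht : p ≤ t - δ)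
    (ht' : t + δ ≤ q) {f : ℝ → ℝ} (hf : ContDiffOn ℝ 3 f (Icc p q))
    (hK : ∀ x ∈ Icc p q, |iteratedDerivWithin 3 f (Icc p q) x| ≤ K) :
    |f (t + δ) - f (t - δ) - 2 * δ * derivWithin f (Icc p q) t| ≤ 2 * K * δ ^ 3 := by
  have hc : t ∈ Icc p q := ⟨by linarith, by linarith⟩
  have h1 := abs_sub_taylor_le_of_contDiffOn (n := 3) hpq hc hf hK (y := t + δ)
    ⟨by linarith, by linarith⟩
  have h2 := abs_sub_taylor_le_of_contDiffOn (n := 3) hpq hc hf hK (y := t - δ)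
    ⟨by linarith, by linarith⟩
  simp only [Finset.sum_range_succ, Finset.sum_range_zero, iteratedDerivWithin_zero,
    iteratedDerivWithin_one, add_sub_cancel_left, sub_sub_cancel_left, abs_neg, abs_of_nonneg hδ,
    pow_zero, pow_one, Nat.factorial] at h1 h2
  rw [abs_le] at *
  push_cast at *
  constructor <;> linarith [h1.1, h1.2, h2.1, h2.2]

lemma abs_average_sub_le {p q t δ K : ℝ} (hpq : p < q) (hδ : 0 ≤ δ) (ht : p ≤ t - δ)
    (ht' : t + δ ≤ q) {f : ℝ → ℝ} (hf : ContDiffOn ℝ 2 f (Icc p q))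
    (hK : ∀ x ∈ Icc p q, |iteratedDerivWithin 2 f (Icc p q) x| ≤ K) :
    |(f (t + δ) + f (t - δ)) / 2 - f t| ≤ K * δ ^ 2 := by
  have hc : t ∈ Icc p q := ⟨by linarith, by linarith⟩
  have h1 := abs_sub_taylor_le_of_contDiffOn (n := 2) hpq hc hf hK (y := t + δ)
    ⟨by linarith, by linarith⟩
  have h2 := abs_sub_taylor_le_of_contDiffOn (n := 2) hpq hc hf hK (y := t - δ)
    ⟨by linarith, by linarith⟩
  simp only [Finset.sum_range_succ, Finset.sum_range_zero, iteratedDerivWithin_zero,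
    iteratedDerivWithin_one, add_sub_cancel_left, sub_sub_cancel_left, abs_neg, abs_of_nonneg hδ,
    pow_zero, pow_one, Nat.factorial] at h1 h2
  rw [abs_le] at *
  push_cast at *
  constructor <;> linarith [h1.1, h1.2, h2.1, h2.2]

/-- The quadratic interpolant at `c - r`, `c`, `c + r` of a function that is a quadratic polynomial
plus `κ (y - c) ^ 3` plus a remainder of order four. -/
lemma abs_sub_quadInterp_sub_cubic_le {p q c r K : ℝ} (hpq : p < q) (hr : 0 < r) (hp : p ≤ c - r)
    (hq : c + r ≤ q) {f : ℝ → ℝ} (hf : ContDiffOn ℝ 4 f (Icc p q))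
    (hK : ∀ x ∈ Icc p q, |iteratedDerivWithin 4 f (Icc p q) x| ≤ K) {s : ℝ} (hs : |s| ≤ r) :
    |f (c + s) - (f (c - r) * (s * (s - r) / (2 * r ^ 2)) + f c * ((r - s) * (r + s) / r ^ 2)
        + f (c + r) * (s * (s + r) / (2 * r ^ 2)))
      - iteratedDerivWithin 3 f (Icc p q) c / 6 * (s ^ 3 - r ^ 2 * s)| ≤ 3 * K * r ^ 4 := by
  have hs' := abs_le.1 hs
  have hc : c ∈ Icc p q := ⟨by linarith, by linarith⟩
  have hK0 : 0 ≤ K := (abs_nonneg _).trans (hK c hc)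
  have h0 := abs_sub_taylor_le_of_contDiffOn (n := 4) hpq hc hf hK (y := c + s)
    ⟨by linarith, by linarith⟩
  have h1 := abs_sub_taylor_le_of_contDiffOn (n := 4) hpq hc hf hK (y := c - r)
    ⟨by linarith, by linarith⟩
  have h2 := abs_sub_taylor_le_of_contDiffOn (n := 4) hpq hc hf hK (y := c + r)
    ⟨by linarith, by linarith⟩
  simp only [Finset.sum_range_succ, Finset.sum_range_zero, iteratedDerivWithin_zero,
    iteratedDerivWithin_one, add_sub_cancel_left, sub_sub_cancel_left, abs_neg, abs_of_pos hr,
    pow_zero, pow_one, Nat.factorial] at h0 h1 h2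
  push_cast at h0 h1 h2
  set d1 := derivWithin f (Icc p q) c
  set d2 := iteratedDerivWithin 2 f (Icc p q) c
  set d3 := iteratedDerivWithin 3 f (Icc p q) c
  have h0' := h0.trans (mul_le_mul_of_nonneg_left (pow_le_pow_left₀ (abs_nonneg s) hs 4) hK0)
  set R0 := f (c + s) - (0 + f c * 1 / 1 + d1 * s / 1 + d2 * s ^ 2 / 2 + d3 * s ^ 3 / 6) with hR0
  set R1 := f (c - r) - _ with hR1
  set R2 := f (c + r) - _ with hR2
  set α := s * (s - r) / (2 * r ^ 2) with hα
  set β := s * (s + r) / (2 * r ^ 2) with hβ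
  have hα1 : |α| ≤ 1 := by
    rw [hα, abs_div, abs_of_pos (show (0 : ℝ) < 2 * r ^ 2 by positivity), div_le_one (by positivity),
      abs_le]
    constructor <;> nlinarith
  have hβ1 : |β| ≤ 1 := by
    rw [hβ, abs_div, abs_of_pos (show (0 : ℝ) < 2 * r ^ 2 by positivity), div_le_one (by positivity),
      abs_le]
    constructor <;> nlinarith
  -- Interpolation reproduces quadratics and sends `s^3` to `r^2 s`, so only Taylor remainders
  -- survive. The one at the centre is zero, hence the middle weight is absent; the three left give
  -- the factor `3`.
  have key : f (c + s) - (f (c - r) * α + f c * ((r - s) * (r + s) / r ^ 2) + f (c + r) * β)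
      - d3 / 6 * (s ^ 3 - r ^ 2 * s) = R0 - R1 * α - R2 * β := by
    rw [hR0, hR1, hR2, hα, hβ]
    field_simp
    ring
  rw [key]
  have e1 : |R1 * α| ≤ K * r ^ 4 := by
    rw [abs_mul]
    exact (mul_le_mul h1 hα1 (abs_nonneg _) (by positivity)).trans_eq (mul_one _)
  have e2 : |R2 * β| ≤ K * r ^ 4 := by
    rw [abs_mul]
    exact (mul_le_mul h2 hβ1 (abs_nonneg _) (by positivity)).trans_eq (mul_one _)
  rw [abs_le] at *
  constructor <;> linarith [e1.1, e1.2, e2.1, e2.2, h0'.1, h0'.2]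

end Taylor

/-! ### The piecewise quadratic basis -/

section Basis

variable {a h : ℝ}

lemma mesh_strictMono (hh : 0 < h) : StrictMono (mesh a h) := fun s t hst => by
  unfold mesh
  nlinarith

lemma quadBasis_eq_zero (hh : 0 < h) {m l : ℕ} {y : ℝ}
    (hy : y ∈ Ioo (mesh a h m) (mesh a h (m + 1))) (h0 : l ≠ 2 * m) (h1 : l ≠ 2 * m + 1)
    (h2 : l ≠ 2 * m + 2) : quadBasis a h l y = 0 := by
  have key : ∀ {s t : ℝ}, y ∈ Icc (mesh a h s) (mesh a h t) → s < m + 1 ∧ (m : ℝ) < t :=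
    fun hst => ⟨(mesh_strictMono hh).lt_iff_lt.1 (hst.1.trans_lt hy.2),
      (mesh_strictMono hh).lt_iff_lt.1 (hy.1.trans_le hst.2)⟩
  obtain ⟨j, rfl | rfl⟩ := Nat.even_or_odd' l
  · have hj : ((2 * j : ℕ) : ℝ) / 2 = j := by push_cast; ring
    simp only [quadBasis, hj]
    rw [if_pos (even_two_mul j), if_neg, if_neg]
    · intro hc
      obtain ⟨e1, e2⟩ := key hc
      have e1' : j < m + 1 := by exact_mod_cast e1
      have e2' : m < j + 1 := by exact_mod_cast e2
      omega
    · intro hc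
      obtain ⟨e1, e2⟩ := key hc
      have e1' : j < m + 1 + 1 := by
        have : (j : ℝ) < m + 1 + 1 := by linarith
        exact_mod_cast this
      have e2' : m < j := by exact_mod_cast e2
      omega
  · have hj : ((2 * j + 1 : ℕ) : ℝ) / 2 = j + 1 / 2 := by push_cast; ring
    simp only [quadBasis, hj]
    rw [if_neg (by simp), if_neg]
    intro hc
    obtain ⟨e1, e2⟩ := key hc
    have e1' : j < m + 1 := by
      have : (j : ℝ) < m + 1 := by linarith
      exact_mod_cast this
    have e2' : m < j + 1 := by
      have : (m : ℝ) < j + 1 := by linarith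
      exact_mod_cast this
    omega

lemma quadBasis_left {m : ℕ} {y : ℝ}
    (hy : y ∈ Ioo (mesh a h m) (mesh a h (m + 1))) :
    quadBasis a h (2 * m) y =
      (mesh a h (m + 1) - y) / h * (((mesh a h (m + 1) + mesh a h m) - 2 * y) / h) := by
  have hj : ((2 * m : ℕ) : ℝ) / 2 = m := by push_cast; ring
  simp only [quadBasis, hj]
  -- Openness of the cell matters here: at `x_m` itself the first branch would be selected.
  rw [if_pos (even_two_mul m), if_neg fun hc => absurd hc.2 (not_le.2 hy.1),
    if_pos (Ioo_subset_Icc_self hy)]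

lemma quadBasis_mid {m : ℕ} {y : ℝ}
    (hy : y ∈ Icc (mesh a h m) (mesh a h (m + 1))) :
    quadBasis a h (2 * m + 1) y = 4 * (y - mesh a h m) * (mesh a h (m + 1) - y) / h ^ 2 := by
  have hj : ((2 * m + 1 : ℕ) : ℝ) / 2 = m + 1 / 2 := by push_cast; ring
  simp only [quadBasis, hj]
  rw [show (m : ℝ) + 1 / 2 - 1 / 2 = m by ring, show (m : ℝ) + 1 / 2 + 1 / 2 = m + 1 by ring,
    if_neg (by simp), if_pos hy]

lemma quadBasis_right {m : ℕ} {y : ℝ}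
    (hy : y ∈ Icc (mesh a h m) (mesh a h (m + 1))) :
    quadBasis a h (2 * m + 2) y =
      (y - mesh a h m) / h * ((2 * y - (mesh a h (m + 1) + mesh a h m)) / h) := by
  have hj : ((2 * m + 2 : ℕ) : ℝ) / 2 = m + 1 := by push_cast; ring
  simp only [quadBasis, hj]
  rw [show (m : ℝ) + 1 - 1 = m by ring, if_pos (by simp [parity_simps]), if_pos hy]

/-- On the interior of a cell only the three local basis functions contribute. -/
lemma sum_quadBasis_cell (hh : 0 < h) {M m : ℕ} (hm : m < M) (v : ℕ → ℝ) {y : ℝ}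
    (hy : y ∈ Ioo (mesh a h m) (mesh a h (m + 1))) :
    ∑ l ∈ Finset.range (2 * M + 1), v l * quadBasis a h l y =
      v (2 * m) * quadBasis a h (2 * m) y + v (2 * m + 1) * quadBasis a h (2 * m + 1) y
        + v (2 * m + 2) * quadBasis a h (2 * m + 2) y := by
  have hsub : ({2 * m, 2 * m + 1, 2 * m + 2} : Finset ℕ) ⊆ Finset.range (2 * M + 1) := by
    intro l hl
    simp only [Finset.mem_insert, Finset.mem_singleton, Finset.mem_range] at hl ⊢
    omega
  rw [← Finset.sum_subset hsub, Finset.sum_insert (by simp), Finset.sum_insert (by simp),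
    Finset.sum_singleton, add_assoc]
  intro l _ hl
  simp only [Finset.mem_insert, Finset.mem_singleton, not_or] at hl
  rw [quadBasis_eq_zero hh hy hl.1 hl.2.1 hl.2.2, mul_zero]

lemma measurable_quadBasis (a h : ℝ) (l : ℕ) : Measurable (quadBasis a h l) := by
  unfold quadBasis
  simp only
  split_ifs
  · refine Measurable.ite measurableSet_Icc (by fun_prop) ?_
    exact Measurable.ite measurableSet_Icc (by fun_prop) measurable_const
  · exact Measurable.ite measurableSet_Icc (by fun_prop) measurable_const

lemma abs_quadBasis_le (hh : 0 < h) (l : ℕ) (y : ℝ) : |quadBasis a h l y| ≤ 1 := by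
  unfold quadBasis
  simp only
  split_ifs with h1 h2 h3 h4
  · obtain ⟨e1, e2⟩ := h2
    unfold mesh at *
    rw [div_mul_div_comm, abs_div, abs_of_pos (show 0 < h * h by positivity),
      div_le_one (by positivity), abs_le]
    constructor <;> nlinarith
  · obtain ⟨e1, e2⟩ := h3
    unfold mesh at *
    rw [div_mul_div_comm, abs_div, abs_of_pos (show 0 < h * h by positivity),
      div_le_one (by positivity), abs_le]
    constructor <;> nlinarith
  · simp
  · obtain ⟨e1, e2⟩ := h4
    unfold mesh at *
    rw [abs_div, abs_of_pos (show 0 < h ^ 2 by positivity),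
      div_le_one (by positivity), abs_le]
    constructor <;> nlinarith [sq_nonneg (y - (a + l / 2 * h))]
  · simp

lemma intervalIntegrable_quadBasis_div (hh : 0 < h) {γ : ℝ} (hγ : γ < 1) (l : ℕ) (x c d : ℝ) :
    IntervalIntegrable (fun y => quadBasis a h l y / |x - y| ^ γ) volume c d := by
  refine (intervalIntegrable_kernel hγ x c d).mono_fun
    ((measurable_quadBasis a h l).div (by fun_prop)).aestronglyMeasurable
    (Filter.Eventually.of_forall fun y => ?_)
  simp only [Real.norm_eq_abs, abs_div, abs_one]
  have := abs_quadBasis_le (a := a) hh l y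
  gcongr

end Basis

/-! ### Consistency of the quadrature -/

section Consistency

lemma integral_cubic_eq_zero (c r : ℝ) :
    ∫ y in (c - r)..(c + r), ((y - c) ^ 3 - r ^ 2 * (y - c)) = 0 := by
  rw [intervalIntegral.integral_comp_sub_right (fun s => s ^ 3 - r ^ 2 * s) c,
    intervalIntegral.integral_sub (by simp) (Continuous.intervalIntegrable (by fun_prop) _ _),
    integral_pow, intervalIntegral.integral_const_mul, integral_id]
  push_cast
  ring

/-- The cubic has zero mean, so its product with the frozen kernel at `c` may be subtracted for
free. What remains is the remainder times the kernel, the cubic times the truncation error, and the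
cubic times the oscillation of the frozen kernel. The bound stays an integral so that cells can be
summed. -/
lemma abs_integral_mul_kernel_cell_le {γ : ℝ} (hγ0 : 0 ≤ γ) (hγ : γ < 1) {h x c r κ K B : ℝ}
    (hh : 0 < h) (hr : 0 < r) {E : ℝ → ℝ}
    (hE : IntervalIntegrable (fun y => E y / |x - y| ^ γ) volume (c - r) (c + r))
    (hκ : |κ| ≤ K)
    (hB : ∀ y ∈ Ioo (c - r) (c + r), |E y - κ * ((y - c) ^ 3 - r ^ 2 * (y - c))| ≤ B) :
    |∫ y in (c - r)..(c + r), E y / |x - y| ^ γ| ≤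
      ∫ y in (c - r)..(c + r), (B * (1 / |x - y| ^ γ)
        + K * r ^ 3 * |1 / |x - y| ^ γ - truncKernel γ h x y|
        + K * r ^ 3 * (kernelVariation γ h x (c + r) - kernelVariation γ h x (c - r))) := by
  have hK : 0 ≤ K := (abs_nonneg _).trans hκ
  have hcub : IntervalIntegrable
      (fun y => κ * truncKernel γ h x c * ((y - c) ^ 3 - r ^ 2 * (y - c))) volume (c - r) (c + r) :=
    Continuous.intervalIntegrable (by fun_prop) _ _
  have h1 : ∫ y in (c - r)..(c + r), E y / |x - y| ^ γ =
      ∫ y in (c - r)..(c + r), (E y / |x - y| ^ γ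
        - κ * truncKernel γ h x c * ((y - c) ^ 3 - r ^ 2 * (y - c))) := by
    rw [intervalIntegral.integral_sub hE hcub, intervalIntegral.integral_const_mul,
      integral_cubic_eq_zero, mul_zero, sub_zero]
  rw [h1, ← Real.norm_eq_abs]
  have hint1 := intervalIntegrable_kernel hγ x (c - r) (c + r)
  have hint2 := (hint1.sub ((continuous_truncKernel (γ := γ) hh x).intervalIntegrable _ _)).abs
  refine intervalIntegral.norm_integral_le_of_norm_le (by linarith) ?_
    (((hint1.const_mul B).add (hint2.const_mul (K * r ^ 3))).add (by simp))
  have hne : ∀ᵐ y ∂(volume : Measure ℝ), y ≠ c + r := by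
    simp [ae_iff, measure_singleton]
  filter_upwards [hne] with y hy1 hy2
  have hy : y ∈ Ioo (c - r) (c + r) := ⟨hy2.1, lt_of_le_of_ne hy2.2 hy1⟩
  have hb := hB y hy
  have hw := kernel_nonneg (γ := γ) x y
  have hv := abs_truncKernel_sub_le (x := x) hγ0 hh (Ioo_subset_Icc_self hy)
    (show c ∈ Icc (c - r) (c + r) from ⟨by linarith, by linarith⟩)
  have ho : |(y - c) ^ 3 - r ^ 2 * (y - c)| ≤ r ^ 3 := by
    have hs : |y - c| ≤ r := abs_le.2 ⟨by linarith [hy.1], by linarith [hy.2]⟩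
    have h0 := abs_nonneg (y - c)
    rw [show (y - c) ^ 3 - r ^ 2 * (y - c) = -((y - c) * (r ^ 2 - |y - c| ^ 2)) by
      rw [sq_abs]; ring, abs_neg, abs_mul, abs_of_nonneg (by nlinarith : 0 ≤ r ^ 2 - |y - c| ^ 2)]
    calc |y - c| * (r ^ 2 - |y - c| ^ 2) ≤ r * r ^ 2 := by
          apply mul_le_mul hs (by nlinarith) (by nlinarith) hr.le
      _ = r ^ 3 := by ring
  set o := (y - c) ^ 3 - r ^ 2 * (y - c)
  set w := 1 / |x - y| ^ γ with hwdef
  have hκo : |κ * o| ≤ K * r ^ 3 := by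
    rw [abs_mul]
    exact mul_le_mul hκ ho (abs_nonneg _) hK
  have e : E y / |x - y| ^ γ - κ * truncKernel γ h x c * o =
      (E y - κ * o) * w + κ * o * (w - truncKernel γ h x y)
        + κ * o * (truncKernel γ h x y - truncKernel γ h x c) := by
    rw [div_eq_mul_one_div, ← hwdef]
    ring
  rw [e, Real.norm_eq_abs]
  refine (abs_add_three _ _ _).trans ?_
  rw [abs_mul, abs_mul (κ * o), abs_mul (κ * o), abs_of_nonneg hw]
  have : 0 ≤ K * r ^ 3 := by positivity
  gcongr

lemma mesh_zero (a h : ℝ) : mesh a h 0 = a := by simp [mesh]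

lemma step_pos {a b : ℝ} (hab : a < b) {M : ℕ} (hM : 1 ≤ M) : 0 < step a b M :=
  div_pos (sub_pos.2 hab) (by exact_mod_cast hM)

lemma mesh_step_last (a b : ℝ) {M : ℕ} (hM : 1 ≤ M) : mesh a (step a b M) M = b := by
  have : (M : ℝ) ≠ 0 := by positivity
  unfold mesh step
  field_simp
  ring

lemma step_le {a b : ℝ} (hab : a < b) {M : ℕ} (hM : 1 ≤ M) : step a b M ≤ b - a :=
  div_le_self (sub_nonneg.2 hab.le) (by exact_mod_cast hM)

lemma mesh_mem_Icc {a b : ℝ} (hab : a < b) {M : ℕ} (hM : 1 ≤ M) {s : ℝ} (hs : s ∈ Icc 0 (M : ℝ)) :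
    mesh a (step a b M) s ∈ Icc a b := by
  have hm := (mesh_strictMono (a := a) (step_pos hab hM)).monotone
  constructor
  · simpa only [mesh_zero] using hm hs.1
  · simpa only [mesh_step_last a b hM] using hm hs.2

/-- The constant in the consistency estimate for quadratic interpolation under the kernel. -/
noncomputable def consistencyConst (a b γ K₃ K₄ : ℝ) : ℝ :=
  3 * K₄ * (2 / (1 - γ) * (b - a) ^ (1 - γ)) * (b - a) ^ γ + K₃ * (2 / (1 - γ) + 2) + 2 * K₃

lemma abs_integral_sub_sum_quadBasis_le {a b γ K₃ K₄ : ℝ} (hab : a < b) (hγ0 : 0 ≤ γ) (hγ : γ < 1)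
    {v : ℝ → ℝ} (hv : ContDiffOn ℝ 4 v (Icc a b))
    (h3 : ∀ x ∈ Icc a b, |iteratedDerivWithin 3 v (Icc a b) x| ≤ K₃)
    (h4 : ∀ x ∈ Icc a b, |iteratedDerivWithin 4 v (Icc a b) x| ≤ K₄)
    {M : ℕ} (hM : 1 ≤ M) {x : ℝ} (hx : x ∈ Icc a b) :
    |(∫ y in a..b, v y / |x - y| ^ γ) - ∑ l ∈ Finset.range (2 * M + 1),
        v (mesh a (step a b M) (l / 2)) *
          ∫ y in a..b, quadBasis a (step a b M) l y / |x - y| ^ γ| ≤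
      consistencyConst a b γ K₃ K₄ * step a b M ^ (4 - γ) := by
  have hh := step_pos hab hM
  have hhle := step_le hab hM
  have hend := mesh_step_last a b hM
  have hmem : ∀ {s : ℝ}, s ∈ Icc 0 (M : ℝ) → mesh a (step a b M) s ∈ Icc a b := mesh_mem_Icc hab hM
  set h := step a b M with hdef
  have hK3 : 0 ≤ K₃ := (abs_nonneg _).trans (h3 x hx)
  have hK4 : 0 ≤ K₄ := (abs_nonneg _).trans (h4 x hx)
  set E : ℝ → ℝ := fun y => v y - ∑ l ∈ Finset.range (2 * M + 1),
    v (mesh a h (l / 2)) * quadBasis a h l y with hE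
  have hvint : IntervalIntegrable (fun y => v y / |x - y| ^ γ) volume a b := by
    have := (intervalIntegrable_kernel hγ x a b).mul_continuousOn (g := v)
      (by rw [uIcc_of_le hab.le]; exact hv.continuousOn)
    refine this.congr fun y _ => ?_
    ring
  have hsint : ∀ l ∈ Finset.range (2 * M + 1), IntervalIntegrable
      (fun y => v (mesh a h (l / 2)) * (quadBasis a h l y / |x - y| ^ γ)) volume a b :=
    fun l _ => (intervalIntegrable_quadBasis_div hh hγ l x a b).const_mul _
  have hEeq : (fun y => E y / |x - y| ^ γ) = fun y => v y / |x - y| ^ γ -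
      ∑ l ∈ Finset.range (2 * M + 1),
        v (mesh a h (l / 2)) * (quadBasis a h l y / |x - y| ^ γ) := by
    funext y
    rw [hE]
    simp only [sub_div, Finset.sum_div, mul_div_assoc]
  have hsumint : IntervalIntegrable (fun y => ∑ l ∈ Finset.range (2 * M + 1),
        v (mesh a h (l / 2)) * (quadBasis a h l y / |x - y| ^ γ)) volume a b := by
    have := IntervalIntegrable.sum _ hsint
    refine this.congr fun y _ => ?_
    simp
  have hEint : IntervalIntegrable (fun y => E y / |x - y| ^ γ) volume a b := by
    rw [hEeq]
    exact hvint.sub hsumint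
  have hEI : (∫ y in a..b, v y / |x - y| ^ γ) - ∑ l ∈ Finset.range (2 * M + 1),
      v (mesh a h (l / 2)) * (∫ y in a..b, quadBasis a h l y / |x - y| ^ γ) =
      ∫ y in a..b, E y / |x - y| ^ γ := by
    rw [hEeq, intervalIntegral.integral_sub hvint hsumint,
      intervalIntegral.integral_finsetSum hsint]
    simp only [intervalIntegral.integral_const_mul]
  rw [hEI]
  -- Split into cells.
  set r := h / 2 with hr
  have hr0 : 0 < r := by positivity
  set c : ℕ → ℝ := fun m => mesh a h (m + 1 / 2) with hc
  have hcl : ∀ m : ℕ, mesh a h (m : ℝ) = c m - r := fun m => by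
    simp only [hc, hr, mesh]; ring
  have hcr : ∀ m : ℕ, mesh a h ((m : ℝ) + 1) = c m + r := fun m => by
    simp only [hc, hr, mesh]; ring
  have hcr' : ∀ m : ℕ, mesh a h ((m + 1 : ℕ) : ℝ) = c m + r := fun m => by
    rw [← hcr]; push_cast; rfl
  have hMmem : ∀ m < M, a ≤ c m - r ∧ c m + r ≤ b := by
    intro m hm
    have h1 := (hmem (s := m) ⟨by positivity, by exact_mod_cast hm.le⟩).1
    have h2 := (hmem (s := (m + 1 : ℕ)) ⟨by positivity, by exact_mod_cast hm⟩).2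
    rw [hcl] at h1
    rw [hcr'] at h2
    exact ⟨h1, h2⟩
  have hsubc : ∀ m < M, uIcc (c m - r) (c m + r) ⊆ uIcc a b := by
    intro m hm
    rw [uIcc_of_le (by linarith), uIcc_of_le hab.le]
    exact Icc_subset_Icc (hMmem m hm).1 (hMmem m hm).2
  set G : ℝ → ℝ := fun y => 3 * K₄ * r ^ 4 * (1 / |x - y| ^ γ)
        + K₃ * r ^ 3 * |1 / |x - y| ^ γ - truncKernel γ h x y| with hG
  -- The factor `2 r^4` is the cell width `2r` times the bound `r^3` on the cubic.
  have hcell : ∀ m < M, |∫ y in (c m - r)..(c m + r), E y / |x - y| ^ γ| ≤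
      (∫ y in (c m - r)..(c m + r), G y) + 2 * K₃ * r ^ 4 *
        (kernelVariation γ h x (c m + r) - kernelVariation γ h x (c m - r)) := by
    intro m hm
    obtain ⟨hma, hmb⟩ := hMmem m hm
    have hcm : c m ∈ Icc a b := ⟨by linarith, by linarith⟩
    have := abs_integral_mul_kernel_cell_le (κ := iteratedDerivWithin 3 v (Icc a b) (c m) / 6)
      (K := K₃) (B := 3 * K₄ * r ^ 4) hγ0 hγ hh hr0 (hEint.mono_set (hsubc m hm)) (by
        rw [abs_div, abs_of_pos (by norm_num : (0 : ℝ) < 6)]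
        linarith [h3 _ hcm]) ?_
    · refine this.trans (le_of_eq ?_)
      have hint1 := intervalIntegrable_kernel hγ x (c m - r) (c m + r)
      have hint2 := (hint1.sub ((continuous_truncKernel (γ := γ) hh x).intervalIntegrable _ _)).abs
      rw [intervalIntegral.integral_add ((hint1.const_mul _).add (hint2.const_mul _)) (by simp),
        intervalIntegral.integral_const, smul_eq_mul]
      rw [hG]
      ring
    · intro y hy
      have hy' : y ∈ Ioo (mesh a h m) (mesh a h (m + 1)) := by rwa [hcl, hcr]
      have hI := abs_sub_quadInterp_sub_cubic_le (c := c m) (s := y - c m) hab hr0 hma hmb hv h4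
        (abs_le.2 ⟨by linarith [hy.1], by linarith [hy.2]⟩)
      rw [add_sub_cancel] at hI
      refine (le_of_eq ?_).trans hI
      congr 2
      rw [hE]
      simp only
      rw [sum_quadBasis_cell hh hm (fun l => v (mesh a h ((l : ℝ) / 2))) hy', quadBasis_left hy',
        quadBasis_mid (Ioo_subset_Icc_self hy'), quadBasis_right (Ioo_subset_Icc_self hy')]
      have e0 : ((2 * m : ℕ) : ℝ) / 2 = m := by push_cast; ring
      have e1 : ((2 * m + 1 : ℕ) : ℝ) / 2 = m + 1 / 2 := by push_cast; ring
      have e2 : ((2 * m + 2 : ℕ) : ℝ) / 2 = m + 1 := by push_cast; ring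
      rw [e0, e1, e2, hcl, hcr, show h = 2 * r by rw [hr]; ring]
      have e3 : mesh a (2 * r) (m + 1 / 2) = c m := by simp only [hc, hr, mesh]; ring
      rw [e3]
      congr 1
      have : r ≠ 0 := hr0.ne'
      congr 1
      · congr 2
        · field_simp
          ring
        · field_simp
          ring
      · field_simp
        ring
  have hsumI : ∀ g : ℝ → ℝ, IntervalIntegrable g volume a b →
      ∑ m ∈ Finset.range M, ∫ y in (c m - r)..(c m + r), g y = ∫ y in a..b, g y := by
    intro g hg
    have := intervalIntegral.sum_integral_adjacent_intervals (f := g) (μ := volume)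
      (a := fun m : ℕ => mesh a h m) (n := M) (fun m hm => by
        rw [hcl, hcr']
        exact hg.mono_set (hsubc m hm))
    simp only [hcr', hend, Nat.cast_zero, mesh_zero] at this
    rw [← this]
    exact Finset.sum_congr rfl fun m _ => by rw [hcl]
  have hint1 := intervalIntegrable_kernel hγ x a b
  have hint2 := (hint1.sub ((continuous_truncKernel (γ := γ) hh x).intervalIntegrable a b)).abs
  have hGint : IntervalIntegrable G volume a b := (hint1.const_mul _).add (hint2.const_mul _)
  have htel : ∑ m ∈ Finset.range M,
      (kernelVariation γ h x (c m + r) - kernelVariation γ h x (c m - r)) =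
      kernelVariation γ h x b - kernelVariation γ h x a := by
    have := Finset.sum_range_sub (fun m : ℕ => kernelVariation γ h x (mesh a h m)) M
    simp only [hcr', hend, Nat.cast_zero, mesh_zero] at this
    rw [← this]
    exact Finset.sum_congr rfl fun m _ => by rw [hcl]
  have hpow4 : h ^ 4 = h ^ (4 - γ) * h ^ γ := by
    rw [← Real.rpow_add hh, sub_add_cancel]
    norm_cast
  have hpow3 : h ^ 3 * h ^ (1 - γ) = h ^ (4 - γ) := by
    rw [← Real.rpow_natCast, ← Real.rpow_add hh]
    congr 1
    push_cast
    ring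
  have hrh : r ≤ h := by linarith
  calc |∫ y in a..b, E y / |x - y| ^ γ|
      = |∑ m ∈ Finset.range M, ∫ y in (c m - r)..(c m + r), E y / |x - y| ^ γ| := by
        rw [hsumI _ hEint]
    _ ≤ ∑ m ∈ Finset.range M, ((∫ y in (c m - r)..(c m + r), G y) + 2 * K₃ * r ^ 4 *
        (kernelVariation γ h x (c m + r) - kernelVariation γ h x (c m - r))) :=
        (Finset.abs_sum_le_sum_abs _ _).trans
          (Finset.sum_le_sum fun m hm => hcell m (Finset.mem_range.1 hm))
    _ = (3 * K₄ * r ^ 4 * ∫ y in a..b, 1 / |x - y| ^ γ)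
        + (K₃ * r ^ 3 * ∫ y in a..b, |1 / |x - y| ^ γ - truncKernel γ h x y|)
        + 2 * K₃ * r ^ 4 * (kernelVariation γ h x b - kernelVariation γ h x a) := by
        rw [Finset.sum_add_distrib, hsumI G hGint, ← Finset.mul_sum, htel, hG,
          intervalIntegral.integral_add (hint1.const_mul _) (hint2.const_mul _),
          intervalIntegral.integral_const_mul, intervalIntegral.integral_const_mul]
    _ ≤ 3 * K₄ * h ^ 4 * (2 / (1 - γ) * (b - a) ^ (1 - γ))
        + K₃ * h ^ 3 * ((2 / (1 - γ) + 2) * h ^ (1 - γ))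
        + 2 * K₃ * r ^ 4 * (2 * (1 / h ^ γ)) := by
        have i1 := integral_kernel_le hγ hx
        have i2 := integral_abs_kernel_sub_truncKernel_le hγ0 hγ hx hh hhle
        have i3 := abs_le.1 (abs_kernelVariation_le hγ0 hh x b)
        have i4 := abs_le.1 (abs_kernelVariation_le hγ0 hh x a)
        have p1 : 0 ≤ ∫ y in a..b, 1 / |x - y| ^ γ :=
          intervalIntegral.integral_nonneg hab.le fun y _ => kernel_nonneg x y
        have p2 : 0 ≤ ∫ y in a..b, |1 / |x - y| ^ γ - truncKernel γ h x y| :=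
          intervalIntegral.integral_nonneg hab.le fun y _ => abs_nonneg _
        gcongr
        linarith [i3.2, i4.1]
    _ ≤ consistencyConst a b γ K₃ K₄ * h ^ (4 - γ) := by
        -- With `r = h / 2` the left side equals `h ^ (4 - γ) / 8`.
        have hq : r ^ 4 * (2 * (1 / h ^ γ)) ≤ h ^ (4 - γ) := by
          have : 0 < h ^ γ := by positivity
          have e : r ^ 4 * (2 * (1 / h ^ γ)) = h ^ (4 - γ) / 8 := by
            rw [hr, div_pow, hpow4]
            field_simp
            norm_num
          rw [e]
          have : 0 ≤ h ^ (4 - γ) := by positivity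
          linarith
        have hq2 : h ^ 4 ≤ h ^ (4 - γ) * (b - a) ^ γ := by
          rw [hpow4]
          gcongr
        have hC2 : 0 ≤ 2 / (1 - γ) * (b - a) ^ (1 - γ) := by
          have : 0 < 1 - γ := by linarith
          have : 0 < b - a := by linarith
          positivity
        have t1 : 3 * K₄ * h ^ 4 * (2 / (1 - γ) * (b - a) ^ (1 - γ)) ≤
            3 * K₄ * (h ^ (4 - γ) * (b - a) ^ γ) * (2 / (1 - γ) * (b - a) ^ (1 - γ)) := by
          gcongr
        have t2 : K₃ * h ^ 3 * ((2 / (1 - γ) + 2) * h ^ (1 - γ)) =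
            K₃ * (2 / (1 - γ) + 2) * h ^ (4 - γ) := by
          rw [← hpow3]
          ring
        have t3 : 2 * K₃ * r ^ 4 * (2 * (1 / h ^ γ)) ≤ 2 * K₃ * h ^ (4 - γ) := by
          rw [mul_assoc (2 * K₃)]
          gcongr
        rw [t2]
        unfold consistencyConst
        linarith

/-- Consistency applied to the constant `1`: its third and fourth derivatives vanish, so the error
constant is zero. -/
lemma sum_integral_quadBasis {a b γ : ℝ} (hab : a < b) (hγ0 : 0 ≤ γ) (hγ : γ < 1)
    {M : ℕ} (hM : 1 ≤ M) {x : ℝ} (hx : x ∈ Icc a b) :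
    ∑ l ∈ Finset.range (2 * M + 1), ∫ y in a..b, quadBasis a (step a b M) l y / |x - y| ^ γ =
      ∫ y in a..b, 1 / |x - y| ^ γ := by
  have := abs_integral_sub_sum_quadBasis_le (K₃ := 0) (K₄ := 0) (v := fun _ => 1) hab hγ0 hγ
    contDiffOn_const (fun x _ => by simp [iteratedDerivWithin_const])
    (fun x _ => by simp [iteratedDerivWithin_const]) hM hx
  simp only [consistencyConst, one_mul, mul_zero, zero_mul, add_zero] at this
  exact (sub_eq_zero.1 (abs_nonpos_iff.1 this)).symm

end Consistency

/-! ### Nonnegativity of the weights -/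

section Positivity

/-- The positions of a collocation node relative to the cell `[p, p + h]`. -/
def OffCell (p h x : ℝ) : Prop := x ≤ p ∨ x = p + h / 2 ∨ p + h ≤ x

lemma OffCell.reflect {p h x : ℝ} (hx : OffCell p h x) : OffCell p h (2 * p + h - x) := by
  rcases hx with hx | hx | hx
  · exact Or.inr (Or.inr (by linarith))
  · exact Or.inr (Or.inl (by linarith))
  · exact Or.inl (by linarith)

/-- For `x` to the left, both distances are `s` and `t` plus the same `p - x ≥ 0`, so their ratio is
at most `t / s`, and `γ ≤ 1` only lowers it. At the midpoint the distances coincide; to the right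
the larger offset is the closer one. -/
lemma div_kernel_le_of_offCell {γ : ℝ} (hγ0 : 0 ≤ γ) (hγ : γ ≤ 1) {p h x : ℝ} (hx : OffCell p h x)
    {s t : ℝ} (hs : 0 ≤ s) (hst : s ≤ t) (hsum : s + t = h) :
    s / |x - (p + s)| ^ γ ≤ t / |x - (p + t)| ^ γ := by
  -- When `s = 0` one has `t = h`, and `x = p + h` would make a distance vanish.
  rcases hs.eq_or_lt with rfl | hs
  · rw [zero_div]
    positivity
  rcases hx with hx | hx | hx
  · rw [abs_of_nonpos (by linarith), abs_of_nonpos (by linarith)]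
    have h1 : 0 < -(x - (p + s)) := by linarith
    have h2 : 0 < -(x - (p + t)) := by linarith
    set k := -(x - (p + s)) with hk
    set k' := -(x - (p + t)) with hk'
    have hratio : k' ^ γ / k ^ γ ≤ k' / k := by
      rw [← Real.div_rpow h2.le h1.le]
      have h1le : 1 ≤ k' / k := by
        rw [one_le_div h1]
        linarith
      calc (k' / k) ^ γ ≤ (k' / k) ^ (1 : ℝ) := Real.rpow_le_rpow_of_exponent_le h1le hγ
        _ = k' / k := Real.rpow_one _
    have hratio2 : k' / k ≤ t / s := by
      rw [div_le_div_iff₀ h1 hs]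
      nlinarith
    have hfin := hratio.trans hratio2
    have p1 : 0 < k ^ γ := by positivity
    have p2 : 0 < k' ^ γ := by positivity
    rw [div_le_div_iff₀ p1 hs] at hfin
    rw [div_le_div_iff₀ p1 p2]
    linarith
  · have : |x - (p + s)| = |x - (p + t)| := by
      rw [← abs_neg]
      congr 1
      linarith
    rw [this]
    gcongr
  · have h1 : 0 < x - (p + s) := by linarith
    have h2 : 0 < x - (p + t) := by linarith
    rw [abs_of_pos h1, abs_of_pos h2]
    gcongr
    linarith

lemma intervalIntegrable_div_kernel {γ : ℝ} (hγ : γ < 1) {f : ℝ → ℝ} {c d : ℝ}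
    (hf : ContinuousOn f (uIcc c d)) (x : ℝ) :
    IntervalIntegrable (fun y => f y / |x - y| ^ γ) volume c d := by
  refine ((intervalIntegrable_kernel hγ x c d).mul_continuousOn hf).congr fun y _ => ?_
  ring

/-- The integrand changes sign at the midpoint. Pairing `y` with its mirror image `2p + h - y`
leaves a product of two factors of equal sign. -/
lemma integral_endpoint_quadratic_nonneg {γ : ℝ} (hγ0 : 0 ≤ γ) (hγ : γ < 1) {p h x : ℝ}
    (hh : 0 < h) (hx : OffCell p h x) :
    0 ≤ ∫ y in p..(p + h), (y - p) * (2 * y - (2 * p + h)) / |x - y| ^ γ := by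
  set F : ℝ → ℝ := fun y => (y - p) * (2 * y - (2 * p + h)) / |x - y| ^ γ with hF
  have hFint : IntervalIntegrable F volume p (p + h) :=
    intervalIntegrable_div_kernel hγ (by fun_prop) x
  have hFint' : IntervalIntegrable (fun y => F (2 * p + h - y)) volume p (p + h) := by
    have := hFint.comp_sub_left (2 * p + h)
    rw [show 2 * p + h - p = p + h by ring, show 2 * p + h - (p + h) = p by ring] at this
    exact this.symm
  have hrefl : ∫ y in p..(p + h), F (2 * p + h - y) = ∫ y in p..(p + h), F y := by
    rw [intervalIntegral.integral_comp_sub_left F (2 * p + h),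
      show 2 * p + h - p = p + h by ring, show 2 * p + h - (p + h) = p by ring]
  have hnn : 0 ≤ ∫ y in p..(p + h), (F y + F (2 * p + h - y)) := by
    refine intervalIntegral.integral_nonneg (by linarith) fun y hy => ?_
    have e : F y + F (2 * p + h - y) = (2 * y - (2 * p + h)) *
        ((y - p) / |x - (p + (y - p))| ^ γ
          - (p + h - y) / |x - (p + (p + h - y))| ^ γ) := by
      simp only [hF]
      rw [show p + (y - p) = y by ring, show p + (p + h - y) = 2 * p + h - y by ring]
      ring
    rw [e]
    rcases le_total (y - p) (p + h - y) with hle | hle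
    · have := div_kernel_le_of_offCell hγ0 hγ.le hx (sub_nonneg.2 hy.1) hle (by ring)
      exact mul_nonneg_of_nonpos_of_nonpos (by linarith) (by linarith)
    · have := div_kernel_le_of_offCell hγ0 hγ.le hx (sub_nonneg.2 hy.2) hle (by ring)
      exact mul_nonneg (by linarith) (by linarith)
  rw [intervalIntegral.integral_add hFint hFint', hrefl] at hnn
  linarith

lemma integral_quadBasis_cell_nonneg {γ : ℝ} (hγ0 : 0 ≤ γ) (hγ : γ < 1) {a h x : ℝ} (hh : 0 < h)
    {m : ℕ} (hx : OffCell (mesh a h m) h x) (l : ℕ) :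
    0 ≤ ∫ y in (mesh a h m)..(mesh a h (m + 1)), quadBasis a h l y / |x - y| ^ γ := by
  have hlt : mesh a h m < mesh a h (m + 1) := mesh_strictMono hh (by linarith)
  have hnext : mesh a h (m + 1) = mesh a h m + h := by simp only [mesh]; ring
  by_cases h0 : l = 2 * m
  · subst h0
    have e : ∫ y in (mesh a h m)..(mesh a h (m + 1)), quadBasis a h (2 * m) y / |x - y| ^ γ =
        ∫ y in (mesh a h m)..(mesh a h m + h), 1 / h ^ 2 *
          ((mesh a h m + h - y) * (2 * mesh a h m + h - 2 * y) / |x - y| ^ γ) := by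
      rw [← hnext]
      refine intervalIntegral.integral_congr_uIoo fun y hy => ?_
      rw [uIoo_of_le hlt.le] at hy
      rw [quadBasis_left hy, hnext]
      field_simp
      ring
    rw [e, intervalIntegral.integral_const_mul]
    refine mul_nonneg (by positivity) ?_
    -- Reflection in the cell midpoint turns the left endpoint function into the right one and
    -- preserves `OffCell`.
    have h1 := integral_endpoint_quadratic_nonneg hγ0 hγ hh hx.reflect
    have h2 := intervalIntegral.integral_comp_sub_left (a := mesh a h m) (b := mesh a h m + h)
      (fun y => (mesh a h m + h - y) * (2 * mesh a h m + h - 2 * y) / |x - y| ^ γ)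
      (2 * mesh a h m + h)
    rw [show 2 * mesh a h m + h - mesh a h m = mesh a h m + h by ring,
      show 2 * mesh a h m + h - (mesh a h m + h) = mesh a h m by ring] at h2
    rw [← h2]
    refine h1.trans_eq (intervalIntegral.integral_congr fun y _ => ?_)
    rw [show x - (2 * mesh a h m + h - y) = -(2 * mesh a h m + h - x - y) by ring, abs_neg]
    ring
  by_cases h1 : l = 2 * m + 1
  · subst h1
    refine intervalIntegral.integral_nonneg hlt.le fun y hy => ?_
    rw [quadBasis_mid hy]
    have := sub_nonneg.2 hy.1
    have := sub_nonneg.2 hy.2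
    positivity
  by_cases h2 : l = 2 * m + 2
  · subst h2
    have e : ∫ y in (mesh a h m)..(mesh a h (m + 1)), quadBasis a h (2 * m + 2) y / |x - y| ^ γ =
        ∫ y in (mesh a h m)..(mesh a h m + h), 1 / h ^ 2 *
          ((y - mesh a h m) * (2 * y - (2 * mesh a h m + h)) / |x - y| ^ γ) := by
      rw [← hnext]
      refine intervalIntegral.integral_congr_uIoo fun y hy => ?_
      rw [uIoo_of_le hlt.le] at hy
      rw [quadBasis_right (Ioo_subset_Icc_self hy), hnext]
      field_simp
      ring
    rw [e, intervalIntegral.integral_const_mul]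
    exact mul_nonneg (by positivity) (integral_endpoint_quadratic_nonneg hγ0 hγ hh hx)
  · rw [intervalIntegral.integral_congr_uIoo (g := fun _ => 0) fun y hy => ?_]
    · simp
    · rw [uIoo_of_le hlt.le] at hy
      simp only
      rw [quadBasis_eq_zero hh hy h0 h1 h2, zero_div]

lemma offCell_mesh {a h : ℝ} (hh : 0 < h) (m n : ℕ) :
    OffCell (mesh a h m) h (mesh a h ((n : ℝ) / 2)) := by
  have hm := (mesh_strictMono (a := a) hh).monotone
  rcases lt_trichotomy n (2 * m + 1) with hn | hn | hn
  · refine Or.inl (hm ?_)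
    have : (n : ℝ) ≤ 2 * m := by exact_mod_cast Nat.lt_succ_iff.1 hn
    linarith
  · refine Or.inr (Or.inl ?_)
    subst hn
    simp only [mesh]
    push_cast
    ring
  · refine Or.inr (Or.inr ?_)
    have : (2 * m + 2 : ℝ) ≤ n := by exact_mod_cast hn
    have h2 := hm (show (m : ℝ) + 1 ≤ (n : ℝ) / 2 by linarith)
    refine le_trans (le_of_eq ?_) h2
    simp only [mesh]
    ring

lemma node_eq_mesh (a b : ℝ) (M : ℕ) (i : Fin (2 * M - 1)) :
    node a b M i = mesh a (step a b M) (((i + 1 : ℕ) : ℝ) / 2) := by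
  simp [node]

/-- Pointwise positivity fails, but each cell contributes a nonnegative integral because a
collocation node meets a cell's interior only at its midpoint. -/
lemma weight_nonneg {a b γ : ℝ} (hab : a < b) (hγ0 : 0 ≤ γ) (hγ : γ < 1) {M : ℕ} (hM : 1 ≤ M)
    (i : Fin (2 * M - 1)) (l : ℕ) : 0 ≤ weight a b γ M i l := by
  have hh := step_pos hab hM
  have := intervalIntegral.sum_integral_adjacent_intervals (μ := volume)
    (f := fun y => quadBasis a (step a b M) l y / |node a b M i - y| ^ γ)
    (a := fun m : ℕ => mesh a (step a b M) m) (n := M)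
    (fun m _ => intervalIntegrable_quadBasis_div hh hγ l _ _ _)
  simp only [Nat.cast_zero, mesh_zero, mesh_step_last a b hM] at this
  rw [weight, ← this]
  refine Finset.sum_nonneg fun m _ => ?_
  push_cast
  rw [node_eq_mesh]
  exact integral_quadBasis_cell_nonneg hγ0 hγ hh (offCell_mesh hh m _) l

end Positivity

/-! ### Maximum principle and discrete Gronwall bound -/

section Stability

variable {ι : Type*} [Fintype ι] {d : ι → ℝ} {G : Matrix ι ι ℝ}

lemma abs_sum_mul_le (hG : ∀ i j, 0 ≤ G i j) (hd : ∀ i, ∑ j, G i j ≤ d i) {v : ι → ℝ} {B : ℝ}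
    (hv : ∀ j, |v j| ≤ B) (i : ι) : |∑ j, G i j * v j| ≤ d i * B := by
  have hB : 0 ≤ B := (abs_nonneg _).trans (hv i)
  calc |∑ j, G i j * v j| ≤ ∑ j, |G i j * v j| := Finset.abs_sum_le_sum_abs _ _
    _ ≤ ∑ j, G i j * B := Finset.sum_le_sum fun j _ => by
        rw [abs_mul, abs_of_nonneg (hG i j)]
        exact mul_le_mul_of_nonneg_left (hv j) (hG i j)
    _ ≤ d i * B := by
        rw [← Finset.sum_mul]
        exact mul_le_mul_of_nonneg_right (hd i) hB

variable [DecidableEq ι]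

lemma diagonal_sub_mulVec_apply (v : ι → ℝ) (i : ι) :
    (Matrix.diagonal d - G).mulVec v i = d i * v i - ∑ j, G i j * v j := by
  rw [Matrix.sub_mulVec, Pi.sub_apply, Matrix.mulVec_diagonal]
  rfl

lemma abs_diagonal_sub_mulVec_le (hG : ∀ i j, 0 ≤ G i j) (hd : ∀ i, ∑ j, G i j ≤ d i)
    {v : ι → ℝ} {B D : ℝ} (hv : ∀ j, |v j| ≤ B) (hD : ∀ i, d i ≤ D) (i : ι) :
    |(Matrix.diagonal d - G).mulVec v i| ≤ 2 * D * B := by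
  have hB : 0 ≤ B := (abs_nonneg _).trans (hv i)
  have hdi : 0 ≤ d i := (Finset.sum_nonneg fun j _ => hG i j).trans (hd i)
  rw [diagonal_sub_mulVec_apply]
  have h1 := abs_sum_mul_le hG hd hv i
  have h2 : |d i * v i| ≤ d i * B := by
    rw [abs_mul, abs_of_nonneg hdi]
    exact mul_le_mul_of_nonneg_left (hv i) hdi
  have h3 : d i * B ≤ D * B := mul_le_mul_of_nonneg_right (hD i) hB
  have h4 := abs_sub (d i * v i) (∑ j, G i j * v j)
  linarith

/-- A discrete maximum principle. -/
lemma abs_le_of_abs_one_add_smul_mulVec_le (hG : ∀ i j, 0 ≤ G i j) (hd : ∀ i, ∑ j, G i j ≤ d i)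
    {c : ℝ} (hc : 0 ≤ c) {v : ι → ℝ} {B : ℝ}
    (hv : ∀ i, |(1 + c • (Matrix.diagonal d - G)).mulVec v i| ≤ B) (i : ι) : |v i| ≤ B := by
  obtain ⟨k, -, hk⟩ := Finset.exists_max_image Finset.univ (fun i => |v i|) ⟨i, Finset.mem_univ i⟩
  refine (hk i (Finset.mem_univ i)).trans ?_
  have h1 := abs_sum_mul_le hG hd (fun j => hk j (Finset.mem_univ j)) k
  have hdk : 0 ≤ d k := (Finset.sum_nonneg fun j _ => hG k j).trans (hd k)
  have h2 := hv k
  rw [Matrix.add_mulVec, Matrix.one_mulVec, Matrix.smul_mulVec, Pi.add_apply, Pi.smul_apply,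
    diagonal_sub_mulVec_apply, smul_eq_mul] at h2
  have e : (1 + c * d k) * v k =
      (v k + c * (d k * v k - ∑ j, G k j * v j)) + c * ∑ j, G k j * v j := by ring
  -- At an index of maximal `|v|`, the term `c * d k * |v k|` appears on both sides and cancels.
  have h3 : |(1 + c * d k) * v k| ≤ B + c * (d k * |v k|) := by
    rw [e]
    refine (abs_add_le _ _).trans (add_le_add h2 ?_)
    rw [abs_mul, abs_of_nonneg hc]
    exact mul_le_mul_of_nonneg_left h1 hc
  rw [abs_mul, abs_of_nonneg (by positivity)] at h3
  linarith

lemma bijective_one_add_smul_mulVec (hG : ∀ i j, 0 ≤ G i j) (hd : ∀ i, ∑ j, G i j ≤ d i)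
    {c : ℝ} (hc : 0 ≤ c) :
    Function.Bijective (1 + c • (Matrix.diagonal d - G)).mulVec := by
  have hinj : Function.Injective (1 + c • (Matrix.diagonal d - G)).mulVec := by
    intro v w hvw
    funext i
    have := abs_le_of_abs_one_add_smul_mulVec_le hG hd hc (v := v - w) (B := 0) (fun j => by
      rw [Matrix.mulVec_sub, hvw, sub_self]
      simp) i
    exact sub_eq_zero.1 (abs_nonpos_iff.1 this)
  exact ⟨hinj, Matrix.mulVec_surjective_iff_isUnit.2 (Matrix.mulVec_injective_iff_isUnit.1 hinj)⟩

lemma existsUnique_implicit_recursion {V W : Type*} {N : ℕ} {B : V → W} (hB : Function.Bijective B)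
    (v₀ : V) (R : Fin N → V → W) :
    ∃! U : Fin (N + 1) → V, U 0 = v₀ ∧ ∀ k : Fin N, B (U k.succ) = R k (U k.castSucc) := by
  refine ⟨fun k => Fin.induction (motive := fun _ => V) v₀
    (fun k u => (hB.2 (R k u)).choose) k, ⟨rfl, fun k => ?_⟩, ?_⟩
  · simp only [Fin.induction_succ]
    exact (hB.2 _).choose_spec
  · rintro U ⟨h0, hs⟩
    funext k
    induction k using Fin.induction with
    | zero => exact h0
    | succ k ih =>
      apply hB.1
      simp only [Fin.induction_succ]
      rw [hs k, ih]
      exact (hB.2 _).choose_spec.symm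

/-- Inverting the implicit factor costs nothing, and the explicit factor costs at most `1 + τ D`,
since `A` has norm at most `2D`. The closed form is slightly wasteful but closes the induction. -/
lemma abs_le_of_implicit_recursion (hG : ∀ i j, 0 ≤ G i j) (hd : ∀ i, ∑ j, G i j ≤ d i) {D : ℝ}
    (hD : ∀ i, d i ≤ D) (hD0 : 0 ≤ D) {N : ℕ} {τ R : ℝ} (hτ : 0 ≤ τ) (hR : 0 ≤ R)
    {e : Fin (N + 1) → ι → ℝ} {ρ : Fin N → ι → ℝ}
    (h0 : e 0 = 0) (hρ : ∀ k i, |ρ k i| ≤ R)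
    (he : ∀ k : Fin N, (1 + (τ / 2) • (Matrix.diagonal d - G)).mulVec (e k.succ) =
      (1 - (τ / 2) • (Matrix.diagonal d - G)).mulVec (e k.castSucc) + τ • ρ k)
    (k : Fin (N + 1)) (i : ι) : |e k i| ≤ (k : ℕ) * τ * R * (1 + τ * D) ^ (k : ℕ) := by
  induction k using Fin.induction generalizing i with
  | zero => simp [h0]
  | succ k ih =>
    refine abs_le_of_abs_one_add_smul_mulVec_le hG hd (c := τ / 2) (by positivity) (fun i => ?_) i
    rw [he k, Pi.add_apply, Matrix.sub_mulVec, Matrix.one_mulVec, Matrix.smul_mulVec, Pi.sub_apply,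
      Pi.smul_apply, Pi.smul_apply, smul_eq_mul, smul_eq_mul]
    rw [Fin.val_castSucc] at ih
    rw [Fin.val_succ]
    set X := (k : ℕ) * τ * R * (1 + τ * D) ^ (k : ℕ) with hX
    have h1 := ih i
    have h2 : |τ / 2 * (Matrix.diagonal d - G).mulVec (e k.castSucc) i| ≤ τ / 2 * (2 * D * X) := by
      rw [abs_mul, abs_of_nonneg (by positivity)]
      exact mul_le_mul_of_nonneg_left (abs_diagonal_sub_mulVec_le hG hd ih hD i) (by positivity)
    have h3 : |τ * ρ k i| ≤ τ * R := by
      rw [abs_mul, abs_of_nonneg hτ]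
      exact mul_le_mul_of_nonneg_left (hρ k i) hτ
    -- The new residual is padded by the same power so that it becomes the `(k + 1)`-st equal
    -- summand.
    have h4 : τ * R ≤ τ * R * (1 + τ * D) ^ ((k : ℕ) + 1) :=
      le_mul_of_one_le_right (by positivity) (one_le_pow₀ (by nlinarith [mul_nonneg hτ hD0]))
    calc |e k.castSucc i - τ / 2 * (Matrix.diagonal d - G).mulVec (e k.castSucc) i + τ * ρ k i|
        ≤ X + τ / 2 * (2 * D * X) + τ * R :=
          (abs_add_le _ _).trans (add_le_add ((abs_sub _ _).trans (add_le_add h1 h2)) h3)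
      _ ≤ X + τ / 2 * (2 * D * X) + τ * R * (1 + τ * D) ^ ((k : ℕ) + 1) := by linarith
      _ = ((k : ℕ) + 1 : ℕ) * τ * R * (1 + τ * D) ^ ((k : ℕ) + 1) := by
          rw [hX]
          push_cast
          ring

end Stability

/-! ### Solvability and truncation error of the scheme -/

section Scheme

variable {a b γ : ℝ}

lemma node_mem_Ioo (hab : a < b) {M : ℕ} (hM : 1 ≤ M) (i : Fin (2 * M - 1)) :
    node a b M i ∈ Ioo a b := by
  have hm := mesh_strictMono (a := a) (step_pos hab hM)
  have hi : ((i : ℕ) + 1 : ℝ) < 2 * M := by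
    have := i.2
    exact_mod_cast (by omega : (i : ℕ) + 1 < 2 * M)
  constructor
  · simpa only [node, mesh_zero] using hm (show (0 : ℝ) < ((i : ℕ) + 1 : ℝ) / 2 by positivity)
  · simpa only [node, mesh_step_last a b hM] using
      hm (show ((i : ℕ) + 1 : ℝ) / 2 < (M : ℝ) by linarith)

lemma sum_range_eq_boundary_add_interior {M : ℕ} (hM : 1 ≤ M) (g : ℕ → ℝ) :
    ∑ l ∈ Finset.range (2 * M + 1), g l =
      (∑ j : Fin (2 * M - 1), g ((j : ℕ) + 1)) + (g 0 + g (2 * M)) := by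
  obtain ⟨n, hn⟩ : ∃ n, 2 * M = n + 1 := ⟨2 * M - 1, by omega⟩
  rw [hn, Finset.sum_range_succ, Finset.sum_range_succ',
    Fin.sum_univ_eq_sum_range (fun j => g (j + 1)), Nat.add_sub_cancel]
  ring

lemma sum_weight (hab : a < b) (hγ0 : 0 ≤ γ) (hγ : γ < 1) {M : ℕ} (hM : 1 ≤ M)
    (i : Fin (2 * M - 1)) :
    ∑ l ∈ Finset.range (2 * M + 1), weight a b γ M i l = diagCoeff a b γ M i :=
  sum_integral_quadBasis hab hγ0 hγ hM (Ioo_subset_Icc_self (node_mem_Ioo hab hM i))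

lemma sum_interior_weight_le (hab : a < b) (hγ0 : 0 ≤ γ) (hγ : γ < 1) {M : ℕ} (hM : 1 ≤ M)
    (i : Fin (2 * M - 1)) :
    ∑ j : Fin (2 * M - 1), weight a b γ M i ((j : ℕ) + 1) ≤ diagCoeff a b γ M i := by
  rw [← sum_weight hab hγ0 hγ hM i, sum_range_eq_boundary_add_interior hM]
  linarith [weight_nonneg hab hγ0 hγ hM i 0, weight_nonneg hab hγ0 hγ hM i (2 * M)]

/-- A bound for the diagonal coefficients that is uniform in the mesh. -/
noncomputable def diagBound (a b γ : ℝ) : ℝ := 2 / (1 - γ) * (b - a) ^ (1 - γ)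

lemma diagBound_nonneg (hab : a < b) (hγ : γ < 1) : 0 ≤ diagBound a b γ := by
  have : 0 < 1 - γ := by linarith
  have : 0 < b - a := by linarith
  unfold diagBound
  positivity

lemma diagCoeff_le (hab : a < b) (hγ : γ < 1) {M : ℕ} (hM : 1 ≤ M) (i : Fin (2 * M - 1)) :
    diagCoeff a b γ M i ≤ diagBound a b γ :=
  integral_kernel_le hγ (Ioo_subset_Icc_self (node_mem_Ioo hab hM i))

lemma existsUnique_isSchemeSolution (hab : a < b) (hγ0 : 0 ≤ γ) (hγ : γ < 1) (f : ℝ → ℝ → ℝ)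
    (u₀ ga gb : ℝ → ℝ) {M : ℕ} (hM : 1 ≤ M) (N : ℕ) {τ : ℝ} (hτ : 0 ≤ τ) :
    ∃! U, IsSchemeSolution a b γ f u₀ ga gb M N τ U := by
  have hbij : Function.Bijective (1 + (τ / 2) • stiffness a b γ M).mulVec :=
    bijective_one_add_smul_mulVec (fun i j => weight_nonneg hab hγ0 hγ hM i _)
      (fun i => sum_interior_weight_le hab hγ0 hγ hM i) (by positivity)
  have := existsUnique_implicit_recursion (N := N) hbij (fun i => u₀ (node a b M i))
    (fun k v => (1 - (τ / 2) • stiffness a b γ M).mulVec v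
      + τ • (fun i => f (node a b M i) (((k : ℕ) + 1 / 2 : ℝ) * τ))
      + τ • boundaryVec a b γ M (ga (((k : ℕ) + 1 / 2 : ℝ) * τ)) (gb (((k : ℕ) + 1 / 2 : ℝ) * τ)))
  simpa only [IsSchemeSolution, funext_iff] using this

/-- Consistency of the space discretization at a fixed time. -/
lemma abs_stiffness_mulVec_sub_boundaryVec_sub_le {K₃ K₄ : ℝ} (hab : a < b) (hγ0 : 0 ≤ γ)
    (hγ : γ < 1) {v : ℝ → ℝ} (hv : ContDiffOn ℝ 4 v (Icc a b))
    (h3 : ∀ x ∈ Icc a b, |iteratedDerivWithin 3 v (Icc a b) x| ≤ K₃)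
    (h4 : ∀ x ∈ Icc a b, |iteratedDerivWithin 4 v (Icc a b) x| ≤ K₄)
    {M : ℕ} (hM : 1 ≤ M) (i : Fin (2 * M - 1)) :
    |(stiffness a b γ M).mulVec (fun j => v (node a b M j)) i - boundaryVec a b γ M (v a) (v b) i
        - ∫ y in a..b, (v (node a b M i) - v y) / |node a b M i - y| ^ γ| ≤
      consistencyConst a b γ K₃ K₄ * step a b M ^ (4 - γ) := by
  have hx := Ioo_subset_Icc_self (node_mem_Ioo hab hM i)
  refine (le_of_eq ?_).trans (abs_integral_sub_sum_quadBasis_le hab hγ0 hγ hv h3 h4 hM hx)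
  have hint : ∫ y in a..b, (v (node a b M i) - v y) / |node a b M i - y| ^ γ =
      v (node a b M i) * diagCoeff a b γ M i - ∫ y in a..b, v y / |node a b M i - y| ^ γ := by
    rw [diagCoeff, ← intervalIntegral.integral_const_mul, ← intervalIntegral.integral_sub]
    · refine intervalIntegral.integral_congr fun y _ => ?_
      ring
    · exact (intervalIntegrable_kernel hγ _ a b).const_mul _
    · exact intervalIntegrable_div_kernel hγ
        (by rw [uIcc_of_le hab.le]; exact hv.continuousOn) _
  have hsum : ∑ l ∈ Finset.range (2 * M + 1), v (mesh a (step a b M) (l / 2)) *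
      (∫ y in a..b, quadBasis a (step a b M) l y / |node a b M i - y| ^ γ) =
      (∑ j : Fin (2 * M - 1), weight a b γ M i ((j : ℕ) + 1) * v (node a b M j))
        + boundaryVec a b γ M (v a) (v b) i := by
    rw [sum_range_eq_boundary_add_interior hM]
    congr 1
    · refine Finset.sum_congr rfl fun j _ => ?_
      rw [node_eq_mesh a b M j, mul_comm]
      rfl
    · have e0 : mesh a (step a b M) (((0 : ℕ) : ℝ) / 2) = a := by simp [mesh]
      have e1 : mesh a (step a b M) (((2 * M : ℕ) : ℝ) / 2) = b := by
        rw [show ((2 * M : ℕ) : ℝ) / 2 = M by push_cast; ring, mesh_step_last a b hM]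
      rw [e0, e1, boundaryVec, weight, weight]
      ring
  rw [hint, hsum, stiffness, diagonal_sub_mulVec_apply]
  simp only [Matrix.of_apply]
  congr 1
  ring

/-- Consistency of one step of the scheme. -/
lemma exists_truncation_error {T : ℝ} (hT : 0 < T) (hab : a < b) (hγ0 : 0 ≤ γ)
    (hγ : γ < 1) {f : ℝ → ℝ → ℝ} {u₀ ga gb : ℝ → ℝ} {u : ℝ → ℝ → ℝ}
    (hs : IsSmooth a b T u) (hu : IsExactSolution a b T γ f u₀ ga gb u) {K₂ K₃ J₃ J₄ : ℝ}
    (hK2 : ∀ x ∈ Icc a b, ∀ t ∈ Icc 0 T,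
      |iteratedDerivWithin 2 (fun t => u x t) (Icc 0 T) t| ≤ K₂)
    (hK3 : ∀ x ∈ Icc a b, ∀ t ∈ Icc 0 T,
      |iteratedDerivWithin 3 (fun t => u x t) (Icc 0 T) t| ≤ K₃)
    (hJ3 : ∀ x ∈ Icc a b, ∀ t ∈ Icc 0 T,
      |iteratedDerivWithin 3 (fun x => u x t) (Icc a b) x| ≤ J₃)
    (hJ4 : ∀ x ∈ Icc a b, ∀ t ∈ Icc 0 T,
      |iteratedDerivWithin 4 (fun x => u x t) (Icc a b) x| ≤ J₄)
    {M : ℕ} (hM : 1 ≤ M) {k : ℕ} {τ : ℝ} (hτ : 0 < τ) (hk : ((k : ℝ) + 1) * τ ≤ T) :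
    ∃ ρ : Fin (2 * M - 1) → ℝ,
      (∀ i, |ρ i| ≤ (K₃ + diagBound a b γ * K₂) * τ ^ 2
        + consistencyConst a b γ J₃ J₄ * step a b M ^ (4 - γ)) ∧
      (1 + (τ / 2) • stiffness a b γ M).mulVec (fun i => u (node a b M i) (((k : ℝ) + 1) * τ)) =
        (1 - (τ / 2) • stiffness a b γ M).mulVec (fun i => u (node a b M i) ((k : ℝ) * τ))
        + τ • (fun i => f (node a b M i) ((k + 1 / 2 : ℝ) * τ))
        + τ • boundaryVec a b γ M (ga ((k + 1 / 2 : ℝ) * τ)) (gb ((k + 1 / 2 : ℝ) * τ))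
        + τ • ρ := by
  set t : ℝ := (k + 1 / 2 : ℝ) * τ with ht
  have htp : ((k : ℝ) + 1) * τ = t + τ / 2 := by rw [ht]; ring
  have htm : (k : ℝ) * τ = t - τ / 2 := by rw [ht]; ring
  have hk0 : (0 : ℝ) ≤ (k : ℝ) * τ := by positivity
  rw [htp] at hk ⊢
  rw [htm] at hk0 ⊢
  -- The half step is strictly positive, so the equation and boundary data hold there even when `k =
  -- 0`.
  have htI : t ∈ Ioc 0 T := ⟨by linarith, by linarith⟩
  have htI' : t ∈ Icc 0 T := ⟨htI.1.le, htI.2⟩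
  have hnode : ∀ i, node a b M i ∈ Icc a b := fun i => Ioo_subset_Icc_self (node_mem_Ioo hab hM i)
  set A := stiffness a b γ M with hA
  set Vp : Fin (2 * M - 1) → ℝ := fun i => u (node a b M i) (t + τ / 2) with hVp
  set Vm : Fin (2 * M - 1) → ℝ := fun i => u (node a b M i) (t - τ / 2) with hVm
  set V : Fin (2 * M - 1) → ℝ := fun i => u (node a b M i) t with hV
  set δ : Fin (2 * M - 1) → ℝ := (1 / 2 : ℝ) • (Vp + Vm) - V with hδ
  set ut : Fin (2 * M - 1) → ℝ := fun i => derivWithin (fun s => u (node a b M i) s) (Icc 0 T) t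
    with hut
  have hAδ : A.mulVec δ = (1 / 2 : ℝ) • (A.mulVec Vp + A.mulVec Vm) - A.mulVec V := by
    rw [hδ, Matrix.mulVec_sub, Matrix.mulVec_smul, Matrix.mulVec_add]
  have hδle : ∀ i, |δ i| ≤ K₂ * (τ / 2) ^ 2 := by
    intro i
    have := abs_average_sub_le (t := t) (δ := τ / 2) hT (by positivity) hk0 hk
      ((hs.time _ (hnode i)).of_le (by norm_num)) (hK2 _ (hnode i))
    refine (le_of_eq ?_).trans this
    simp only [hδ, hVp, hVm, hV, Pi.sub_apply, Pi.smul_apply, Pi.add_apply, smul_eq_mul]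
    congr 1
    ring
  have hAδle : ∀ i, |A.mulVec δ i| ≤ 2 * diagBound a b γ * (K₂ * (τ / 2) ^ 2) := fun i =>
    abs_diagonal_sub_mulVec_le (fun i j => weight_nonneg hab hγ0 hγ hM i _)
      (fun i => sum_interior_weight_le hab hγ0 hγ hM i) hδle (fun i => diagCoeff_le hab hγ hM i) i
  have hcd : ∀ i, |Vp i - Vm i - τ * ut i| ≤ 2 * K₃ * (τ / 2) ^ 3 := by
    intro i
    have := abs_central_difference_sub_le (t := t) (δ := τ / 2) hT (by positivity) hk0 hk
      (hs.time _ (hnode i)) (hK3 _ (hnode i))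
    rwa [show 2 * (τ / 2) = τ by ring] at this
  set I : Fin (2 * M - 1) → ℝ := fun i =>
    ∫ y in a..b, (u (node a b M i) t - u y t) / |node a b M i - y| ^ γ with hI
  have heq : ∀ i, f (node a b M i) t = ut i + I i := fun i =>
    (hu.eqn _ (node_mem_Ioo hab hM i) t htI).symm
  have hsp : ∀ i, |A.mulVec V i - boundaryVec a b γ M (ga t) (gb t) i - I i| ≤
      consistencyConst a b γ J₃ J₄ * step a b M ^ (4 - γ) := by
    intro i
    rw [← hu.left t htI, ← hu.right t htI]
    exact abs_stiffness_mulVec_sub_boundaryVec_sub_le hab hγ0 hγ (hs.space t htI')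
      (fun x hx => hJ3 x hx t htI') (fun x hx => hJ4 x hx t htI') hM i
  -- The residual collects three errors: central difference in time, time averaging seen through
  -- `A`, and space discretization at the half step.
  refine ⟨fun i => (Vp i - Vm i - τ * ut i) / τ + A.mulVec δ i
    + (A.mulVec V i - boundaryVec a b γ M (ga t) (gb t) i - I i), fun i => ?_, ?_⟩
  · have h1 : |(Vp i - Vm i - τ * ut i) / τ| ≤ K₃ * τ ^ 2 / 4 := by
      rw [abs_div, abs_of_pos hτ, div_le_iff₀ hτ]
      refine (hcd i).trans (le_of_eq ?_)
      ring
    have hK3' : 0 ≤ K₃ := (abs_nonneg _).trans (hK3 _ (hnode i) t htI')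
    have hK2' : 0 ≤ K₂ := (abs_nonneg _).trans (hK2 _ (hnode i) t htI')
    have h2 : 0 ≤ K₃ * τ ^ 2 := by positivity
    have h3 : 0 ≤ diagBound a b γ * K₂ * τ ^ 2 := by
      have := diagBound_nonneg hab hγ
      positivity
    have h4 : 2 * diagBound a b γ * (K₂ * (τ / 2) ^ 2) = diagBound a b γ * K₂ * τ ^ 2 / 2 := by
      ring
    have h5 := hAδle i
    refine (abs_add_three _ _ _).trans ?_
    linarith [hsp i]
  · funext i
    simp only [Matrix.add_mulVec, Matrix.sub_mulVec, Matrix.one_mulVec, Matrix.smul_mulVec,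
      Pi.add_apply, Pi.sub_apply, Pi.smul_apply, smul_eq_mul]
    rw [hAδ, heq i]
    simp only [Pi.add_apply, Pi.sub_apply, Pi.smul_apply, smul_eq_mul]
    field_simp
    ring

lemma exists_bound_of_continuousOn_prod {T : ℝ} {F : ℝ × ℝ → ℝ}
    (hF : ContinuousOn F (Icc a b ×ˢ Icc 0 T)) :
    ∃ K, 0 ≤ K ∧ ∀ x ∈ Icc a b, ∀ t ∈ Icc 0 T, |F (x, t)| ≤ K := by
  obtain ⟨K, hK⟩ := (isCompact_Icc.prod isCompact_Icc).exists_bound_of_continuousOn hF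
  exact ⟨max K 0, le_max_right _ _, fun x hx t ht => (hK (x, t) ⟨hx, ht⟩).trans (le_max_left _ _)⟩

end Scheme

end NonlocalCN

/-! ### Convergence -/

open NonlocalCN in
theorem theorem3p7 (a b T γ : ℝ) (hab : a < b) (hT : 0 < T) (hγ0 : 0 < γ) (hγ1 : γ < 1)
    (f : ℝ → ℝ → ℝ) (u₀ ga gb : ℝ → ℝ) (u : ℝ → ℝ → ℝ)
    (hsmooth : NonlocalCN.IsSmooth a b T u) (hu : NonlocalCN.IsExactSolution a b T γ f u₀ ga gb u) :
    ∃ C : ℝ, 0 < C ∧ ∀ (M N : ℕ) (τ : ℝ), 1 ≤ M → 0 < τ → (N : ℝ) * τ ≤ T →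
      (∃! U, NonlocalCN.IsSchemeSolution a b γ f u₀ ga gb M N τ U) ∧
      ∀ U, NonlocalCN.IsSchemeSolution a b γ f u₀ ga gb M N τ U →
        ∀ (k : Fin (N + 1)) (i : Fin (2 * M - 1)),
          |u (NonlocalCN.node a b M i) ((k : ℕ) * τ) - U k i|
            ≤ C * (τ ^ 2 + NonlocalCN.step a b M ^ (4 - γ)) := by
  obtain ⟨K₂, hK20, hK2⟩ := exists_bound_of_continuousOn_prod (hsmooth.time_cont 2 (by norm_num))
  obtain ⟨K₃, hK30, hK3⟩ := exists_bound_of_continuousOn_prod (hsmooth.time_cont 3 le_rfl)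
  obtain ⟨J₃, hJ30, hJ3⟩ := exists_bound_of_continuousOn_prod (hsmooth.space_cont 3 (by norm_num))
  obtain ⟨J₄, hJ40, hJ4⟩ := exists_bound_of_continuousOn_prod (hsmooth.space_cont 4 le_rfl)
  have hD := diagBound_nonneg hab hγ1
  have hCs : 0 ≤ consistencyConst a b γ J₃ J₄ := by
    have : 0 < 1 - γ := by linarith
    have : 0 < b - a := by linarith
    unfold consistencyConst
    positivity
  set D := diagBound a b γ with hDdef
  set Cs := consistencyConst a b γ J₃ J₄ with hCsdef
  set C := K₃ + D * K₂ + Cs with hC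
  have hC0 : 0 ≤ C := by positivity
  -- The product is the Gronwall bound; `+ 1` keeps the constant positive when `C = 0`.
  refine ⟨T * C * Real.exp (T * D) + 1, by positivity, fun M N τ hM hτ hN =>
    ⟨existsUnique_isSchemeSolution hab hγ0.le hγ1 f u₀ ga gb hM N hτ.le, fun U hU k i => ?_⟩⟩
  have hh := step_pos hab hM
  set h := step a b M with hh_def
  have hp : 0 ≤ h ^ (4 - γ) := by positivity
  have hkτ : ∀ m : ℕ, m ≤ N → (m : ℝ) * τ ≤ T := fun m hm => by
    refine le_trans ?_ hN
    gcongr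
  have htrunc : ∀ m : Fin N, ∃ ρ : Fin (2 * M - 1) → ℝ, _ := fun m =>
    exists_truncation_error (k := m) hT hab hγ0.le hγ1 hsmooth hu hK2 hK3 hJ3 hJ4 hM hτ
      (by exact_mod_cast hkτ (m + 1) m.2)
  choose ρ hρ hρeq using htrunc
  have hR : ∀ m i, |ρ m i| ≤ C * (τ ^ 2 + h ^ (4 - γ)) := by
    intro m i
    refine (hρ m i).trans ?_
    have h1 : 0 ≤ Cs * τ ^ 2 := by positivity
    have h2 : 0 ≤ (K₃ + D * K₂) * h ^ (4 - γ) := by positivity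
    rw [hC]
    linarith
  have key := abs_le_of_implicit_recursion (d := diagCoeff a b γ M)
    (G := Matrix.of fun i (j : Fin (2 * M - 1)) => weight a b γ M i ((j : ℕ) + 1)) (fun i j => weight_nonneg hab hγ0.le hγ1 hM i _)
    (fun i => sum_interior_weight_le hab hγ0.le hγ1 hM i) (fun i => diagCoeff_le hab hγ1 hM i) hD
    (N := N) (R := C * (τ ^ 2 + h ^ (4 - γ))) hτ.le (by positivity)
    (e := fun k i => u (node a b M i) ((k : ℕ) * τ) - U k i) (ρ := ρ) ?_ hR ?_ k i
  · have hk : ((k : ℕ) : ℝ) * τ ≤ T := hkτ k (Nat.lt_succ_iff.1 k.2)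
    have hpow : (1 + τ * D) ^ (k : ℕ) ≤ Real.exp (T * D) := by
      calc (1 + τ * D) ^ (k : ℕ) ≤ Real.exp (τ * D) ^ (k : ℕ) := by
            gcongr
            linarith [Real.add_one_le_exp (τ * D)]
        _ = Real.exp ((k : ℕ) * τ * D) := by
            rw [← Real.exp_nat_mul]
            congr 1
            ring
        _ ≤ Real.exp (T * D) := by gcongr
    refine key.trans ?_
    calc ((k : ℕ) : ℝ) * τ * (C * (τ ^ 2 + h ^ (4 - γ))) * (1 + τ * D) ^ (k : ℕ)
        ≤ T * (C * (τ ^ 2 + h ^ (4 - γ))) * Real.exp (T * D) := by gcongr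
      _ ≤ (T * C * Real.exp (T * D) + 1) * (τ ^ 2 + h ^ (4 - γ)) := by
          have : 0 ≤ τ ^ 2 + h ^ (4 - γ) := by positivity
          linarith
  · funext i
    have : u (node a b M i) 0 = u₀ (node a b M i) := hu.initial _ (node_mem_Ioo hab hM i)
    simp [hU.1 i, this]
  -- Subtracting the scheme from the identity for the exact solution cancels source and boundary
  -- data, leaving `τ • ρ m`.
  · intro m
    have e1 := hρeq m
    have e2 := hU.2 m
    unfold stiffness at e1 e2
    have hs : ∀ n : Fin (N + 1), (fun i => u (node a b M i) (((n : ℕ) : ℝ) * τ) - U n i) =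
        (fun i => u (node a b M i) (((n : ℕ) : ℝ) * τ)) - U n := fun n => rfl
    simp only [hs, Matrix.mulVec_sub]
    rw [Fin.val_succ, Fin.val_castSucc]
    push_cast
    rw [e1, e2]
    abel
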